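/- For a sequence $\beta=\{\beta(n)\}_{n\ge 0}$ of positive numbers let $H^2(\beta)$ be the Hilbert space of power series $f(z)=\sum a_n z^n$ with $\|f\|^2=\sum|a_n|^2\beta(n)^2<\infty$. Let $a,c,d\in\mathbb C$ with $a\neq0$ be such that $\varphi(z)=az/(cz+d)$ is a holomorphic self-map of the open unit disk $\mathbb D$ (in particular $cz+d\ne0$ on $\mathbb D$), and let $\sigma(z)=(\bar a/\bar d)z-\bar c/\bar d$. For a self-map $\psi$ of $\mathbb D$ and a function $G$ on $\mathbb D$ write $C_\psi f=f\circ\psi$ and $M_Gf=Gf$; adjoints are taken in the space on which the operators act. (1) Let $t\in\mathbb R$, $0<\ell<\infty$ and suppose $\lim_{n\to\infty}\beta(n)/n^t=\ell$. Put $G(z)=\bigl(-(c/a)z+1\bigr)^{2t-1}$ (principal branch). Then $\sigma$ maps $\mathbb D$ into itself, $C_\varphi$ and $C_\sigma$ are bounded on $H^2(\beta)$, and, whenever $M_G$ is a bounded operator on $H^2(\beta)$, the operator $C_\varphi^*-M_G^*C_\sigma$ is compact on $H^2(\beta)$. The operator $M_G$ is bounded on $H^2(\beta)$ in each of the following cases: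 $|c|<|a|$; $|c|=|a|$ and $t\ge 1/2$; $2t-1$ is a nonnegative integer. (2) The space $S^2(\mathbb D)$ of all analytic functions $f$ on $\mathbb D$ with $f'\in H^2$, normed by $\|f\|^2=|f(0)|^2+\|f'\|_{H^2}^2$, is $H^2(\beta)$ for $\beta(0)=1$, $\beta(n)=n$ $(n\ge1)$, with the same norm. On $S^2(\mathbb D)$ (the case $t=1$) the operators $C_\varphi$, $C_\sigma$ and $M_G$ with $G(z)=-(c/a)z+1$ are bounded, and $C_\varphi^*-M_G^*C_\sigma$ is compact. -/

import Mathlib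

open Filter Topology Metric Set

noncomputable section

/-- The weighted Hardy space `H²(β)`: the power series `∑ aₙ zⁿ` with `∑ |aₙ|² β(n)² < ∞`, normed by
`‖∑ aₙ zⁿ‖² = ∑ |aₙ|² β(n)²`.  An element is stored as the square-summable sequence
`xₙ = aₙ β(n)`; its Taylor coefficients are `aₙ = xₙ / β(n)`. -/
def WeightedHardy (_β : ℕ → ℝ) : Type := lp (fun _ : ℕ => ℂ) 2

namespace WeightedHardy

instance (β : ℕ → ℝ) : NormedAddCommGroup (WeightedHardy β) :=
  inferInstanceAs (NormedAddCommGroup (lp (fun _ : ℕ => ℂ) 2))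

instance (β : ℕ → ℝ) : InnerProductSpace ℂ (WeightedHardy β) :=
  inferInstanceAs (InnerProductSpace ℂ (lp (fun _ : ℕ => ℂ) 2))

instance (β : ℕ → ℝ) : CompleteSpace (WeightedHardy β) :=
  inferInstanceAs (CompleteSpace (lp (fun _ : ℕ => ℂ) 2))

/-- The underlying square-summable sequence `aₙ β(n)`. -/
def toLp {β : ℕ → ℝ} (f : WeightedHardy β) : lp (fun _ : ℕ => ℂ) 2 := f

/-- The `n`-th Taylor coefficient `aₙ` of `f = ∑ aₙ zⁿ`. -/
def coeff {β : ℕ → ℝ} (f : WeightedHardy β) (n : ℕ) : ℂ := f.toLp n / (β n : ℂ)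

/-- The value `f(z) = ∑ aₙ zⁿ` at a point `z` of the unit disk. -/
def eval {β : ℕ → ℝ} (f : WeightedHardy β) (z : ℂ) : ℂ := ∑' n, f.coeff n * z ^ n

/-- The norm is `‖f‖² = ∑ |aₙ|² β(n)²`. -/
theorem hasSum_norm_sq {β : ℕ → ℝ} (hβ : ∀ n, 0 < β n) (f : WeightedHardy β) :
    HasSum (fun n => ‖f.coeff n‖ ^ 2 * β n ^ 2) (‖f‖ ^ 2) := by
  have h := lp.hasSum_norm (p := 2) (by norm_num) f.toLp
  have h2 : ‖f.toLp‖ = ‖f‖ := rfl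
  rw [h2] at h
  have e : (2 : ENNReal).toReal = 2 := by norm_num
  rw [e] at h
  simp only [Real.rpow_two] at h
  convert h using 2 with n
  have : ‖((β n : ℝ) : ℂ)‖ = β n := by
    rw [Complex.norm_real, Real.norm_of_nonneg (hβ n).le]
  rw [coeff, norm_div, this, div_pow, div_mul_cancel₀]
  exact pow_ne_zero _ (hβ n).ne'

/-- When `β(n) ~ ℓ nᵗ`, the power series of an element of `H²(β)` converges on the unit disk. -/
theorem hasSum_eval {β : ℕ → ℝ} (hβ : ∀ n, 0 < β n) {t ℓ : ℝ} (hℓ : 0 < ℓ)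
    (hlim : Tendsto (fun n : ℕ => β n / (n : ℝ) ^ t) atTop (𝓝 ℓ))
    (f : WeightedHardy β) {z : ℂ} (hz : z ∈ ball (0 : ℂ) 1) :
    HasSum (fun n => f.coeff n * z ^ n) (f.eval z) := by
  refine Summable.hasSum ?_
  obtain ⟨k, hk⟩ := exists_nat_ge (-t)
  have hz1 : ‖z‖ < 1 := by simpa using hz
  have hs := summable_pow_mul_geometric_of_norm_lt_one (R := ℝ) k (r := ‖z‖) (by simpa using hz1)
  refine summable_of_isBigO_nat hs ?_
  refine Asymptotics.IsBigO.of_bound (‖f‖ * (2 / ℓ)) ?_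
  filter_upwards [hlim.eventually (lt_mem_nhds (half_lt_self hℓ)), eventually_ge_atTop 1]
    with n hn h1
  have hn1 : (1 : ℝ) ≤ n := by exact_mod_cast h1
  have hnt : 0 < (n : ℝ) ^ t := by positivity
  have hb : ℓ / 2 * (n : ℝ) ^ t < β n := (lt_div_iff₀ hnt).1 hn
  have hx : ‖f.toLp n‖ ≤ ‖f‖ := lp.norm_apply_le_norm (by norm_num) f.toLp n
  have hpow : (n : ℝ) ^ (-t) ≤ (n : ℝ) ^ k := by
    rw [← Real.rpow_natCast]
    exact Real.rpow_le_rpow_of_exponent_le hn1 hk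
  have hc : ‖f.coeff n‖ ≤ ‖f‖ * (2 / ℓ) * (n : ℝ) ^ k := by
    have h3 : ‖((β n : ℝ) : ℂ)‖ = β n := by
      rw [Complex.norm_real, Real.norm_of_nonneg (hβ n).le]
    rw [coeff, norm_div, h3]
    calc ‖f.toLp n‖ / β n ≤ ‖f‖ / (ℓ / 2 * (n : ℝ) ^ t) := by gcongr
      _ = ‖f‖ * (2 / ℓ) * (n : ℝ) ^ (-t) := by
        rw [Real.rpow_neg (by positivity)]; field_simp
      _ ≤ _ := by gcongr
  rw [norm_mul, norm_pow, norm_mul, norm_pow, norm_pow, norm_norm, Real.norm_natCast]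
  calc ‖f.coeff n‖ * ‖z‖ ^ n ≤ ‖f‖ * (2 / ℓ) * (n : ℝ) ^ k * ‖z‖ ^ n := by gcongr
    _ = _ := by ring

/-- When `β(n) ~ ℓ nᵗ`, an element of `H²(β)` is determined by its values on the unit disk. -/
theorem ext_eval {β : ℕ → ℝ} (hβ : ∀ n, 0 < β n) {t ℓ : ℝ} (hℓ : 0 < ℓ)
    (hlim : Tendsto (fun n : ℕ => β n / (n : ℝ) ^ t) atTop (𝓝 ℓ))
    (f g : WeightedHardy β) (h : ∀ z ∈ ball (0 : ℂ) 1, f.eval z = g.eval z) : f = g := by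
  have key : ∀ f : WeightedHardy β, HasFPowerSeriesAt f.eval
      (FormalMultilinearSeries.ofScalars ℂ f.coeff) 0 := by
    intro f
    rw [hasFPowerSeriesAt_iff]
    filter_upwards [ball_mem_nhds (0 : ℂ) one_pos] with z hz
    have := hasSum_eval hβ hℓ hlim f hz
    simpa [FormalMultilinearSeries.coeff_ofScalars, mul_comm] using this
  have he : f.eval =ᶠ[𝓝 0] g.eval := by
    filter_upwards [ball_mem_nhds (0 : ℂ) one_pos] with z hz using h z hz
  have heq := ((key f).congr he).eq_formalMultilinearSeries (key g)
  refine lp.ext (E := fun _ : ℕ => ℂ) (p := 2) (funext fun n => ?_)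
  have h1 : f.coeff n = g.coeff n := by
    have := congrArg (fun p => FormalMultilinearSeries.coeff p n) heq
    simpa [FormalMultilinearSeries.coeff_ofScalars] using this
  have hn : ((β n : ℝ) : ℂ) ≠ 0 := by exact_mod_cast (hβ n).ne'
  exact (div_left_inj' hn).1 h1

/-- `T` is the composition operator `C_φ f = f ∘ φ` of a self-map `φ` of the unit disk. -/
def IsCompositionOperator {β : ℕ → ℝ} (φ : ℂ → ℂ)
    (T : WeightedHardy β →L[ℂ] WeightedHardy β) : Prop :=
  MapsTo φ (ball 0 1) (ball 0 1) ∧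
    ∀ f : WeightedHardy β, ∀ z ∈ ball (0 : ℂ) 1, (T f).eval z = f.eval (φ z)

/-- `T` is the multiplication operator `M_G f = G f`. -/
def IsMultiplicationOperator {β : ℕ → ℝ} (G : ℂ → ℂ)
    (T : WeightedHardy β →L[ℂ] WeightedHardy β) : Prop :=
  ∀ f : WeightedHardy β, ∀ z ∈ ball (0 : ℂ) 1, (T f).eval z = G z * f.eval z

/-- The function `f`, restricted to the unit disk, belongs to `H²(β)`. -/
def Mem (β : ℕ → ℝ) (f : ℂ → ℂ) : Prop :=
  ∃ F : WeightedHardy β, ∀ z ∈ ball (0 : ℂ) 1, f z = F.eval z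

end WeightedHardy

/-- The weights `β(0) = 1`, `β(n) = n` for `n ≥ 1`. -/
def sobolevWeight (n : ℕ) : ℝ := if n = 0 then 1 else n

/-- The constant weights `β(n) = 1`; the space `H²(β)` is then the classical Hardy space `H²`. -/
def hardyWeight (_n : ℕ) : ℝ := 1

end

/-! Put `P = a/d` and `Q = -c/d`, so that `φ(z) = Pz/(1 - Qz)` and `σ(z) = P̄z + Q̄`. Testing `φ` at
suitable points shows that a self-map of the disk satisfies `|P| + |Q| ≤ 1`, and then `σ` is a
self-map too. In the orthonormal basis `zᵐ/β(m)` the matrix of `C_σ` has entries `C(m,n) P̄ⁿ Q̄ᵐ⁻ⁿ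
β(n)/β(m)`. That of `C_φ*` has entries `(n/m) C(m,n) P̄ⁿ Q̄ᵐ⁻ⁿ β(m)/β(n)`, because the coefficient
`C(m-1,n-1)` equals `(n/m) C(m,n)`. Both are dominated by the binomial kernel with `p = |P|`, `q =
|Q|`, times a power of `(m+1)/(n+1)`. The Schur test gives boundedness, and it gives compactness
when the column sums tend to zero. If `p + q < 1`, the column sums decay geometrically and both
operators are compact. If `p + q = 1`, column `m` is a binomial distribution concentrated at `n ≈
pm`, where the quotient of the two entries, `(n/m)(β(m)/β(n))²`, tends to `p^(1-2t)`. Hence `C_φ* ≡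
p^(1-2t) C_σ` modulo compacts (`isCompactOperator_adjoint_fractional_sub`). The same concentration
gives `S* C_σ ≡ w̄ C_σ` for the shift `S`, where `w` is the boundary point that `σ` sends to the
circle (when `c ≠ 0`). If `M_G` is a norm-convergent power series in `S`, it follows that `M_G* C_σ
≡ conj(G(w)) C_σ`, and `G(w) = (1 + |c|/|a|)^(2t-1) = p^(1-2t)` is the same constant. It remains to
see that a bounded `M_G` is such a series (`isShiftSeries_cpow`). For `t > 1/2` the space is an
algebra and every multiplier qualifies. For `t < 1/2` boundedness of `G` forces `|c| < |a|`, and the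
binomial series converges geometrically. For `t = 1/2`, `G = 1`. -/

noncomputable section

open scoped ENNReal NNReal

/-! ### The Schur test for nonnegative kernels. -/

/-- Weighted Cauchy–Schwarz inequality for sums of extended nonnegative reals. -/
theorem ENNReal.sq_tsum_mul_le {ι : Type*} (κ x : ι → ℝ≥0∞) :
    (∑' m, κ m * x m) ^ 2 ≤ (∑' m, κ m) * ∑' m, κ m * x m ^ 2 := by
  let _ : MeasurableSpace ι := ⊤
  have h := ENNReal.lintegral_mul_le_Lp_mul_Lq (MeasureTheory.Measure.count (α := ι))
    (p := 2) (q := 2) Real.HolderConjugate.two_two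
    (f := fun m => κ m ^ (1 / 2 : ℝ)) (g := fun m => κ m ^ (1 / 2 : ℝ) * x m)
    measurable_from_top.aemeasurable measurable_from_top.aemeasurable
  simp only [MeasureTheory.lintegral_count, Pi.mul_apply] at h
  have e1 : ∀ m, κ m ^ (1 / 2 : ℝ) * (κ m ^ (1 / 2 : ℝ) * x m) = κ m * x m := by
    intro m
    rw [← mul_assoc, ← ENNReal.rpow_add_of_nonneg _ _ (by norm_num) (by norm_num)]
    norm_num
  have e2 : ∀ m, (κ m ^ (1 / 2 : ℝ)) ^ (2 : ℝ) = κ m := by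
    intro m
    rw [← ENNReal.rpow_mul]; norm_num
  have e3 : ∀ m, (κ m ^ (1 / 2 : ℝ) * x m) ^ (2 : ℝ) = κ m * x m ^ 2 := by
    intro m
    rw [ENNReal.mul_rpow_of_nonneg _ _ (by norm_num), e2, ENNReal.rpow_two]
  simp only [e1, e2, e3] at h
  calc (∑' m, κ m * x m) ^ 2
      ≤ ((∑' m, κ m) ^ (1 / 2 : ℝ) * (∑' m, κ m * x m ^ 2) ^ (1 / 2 : ℝ)) ^ 2 := by gcongr
    _ = _ := by
      rw [mul_pow, ← ENNReal.rpow_natCast, ← ENNReal.rpow_natCast, ← ENNReal.rpow_mul,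
        ← ENNReal.rpow_mul]
      norm_num

/-- The Schur test for nonnegative kernels. -/
theorem ENNReal.schur_test {κ : ℕ → ℕ → ℝ≥0∞} {A B : ℝ≥0∞}
    (hrow : ∀ n, ∑' m, κ n m ≤ B) (hcol : ∀ m, ∑' n, κ n m ≤ A) (x : ℕ → ℝ≥0∞) :
    ∑' n, (∑' m, κ n m * x m) ^ 2 ≤ B * A * ∑' m, x m ^ 2 := by
  calc ∑' n, (∑' m, κ n m * x m) ^ 2
      ≤ ∑' n, B * ∑' m, κ n m * x m ^ 2 := by
        refine ENNReal.tsum_le_tsum fun n => (ENNReal.sq_tsum_mul_le _ _).trans ?_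
        gcongr
        exact hrow n
    _ = B * ∑' m, (∑' n, κ n m) * x m ^ 2 := by
        rw [ENNReal.tsum_mul_left, ENNReal.tsum_comm]
        simp only [ENNReal.tsum_mul_right]
    _ ≤ B * ∑' m, A * x m ^ 2 := by
        gcongr with m
        exact hcol m
    _ = _ := by rw [ENNReal.tsum_mul_left, mul_assoc]

/-! ### Matrices of operators: boundedness and compactness from row and column sums. -/

namespace WeightedHardy

variable {β : ℕ → ℝ}

@[simp] theorem toLp_add (f g : WeightedHardy β) (n : ℕ) :
    (f + g).toLp n = f.toLp n + g.toLp n := rfl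
@[simp] theorem toLp_smul (r : ℂ) (g : WeightedHardy β) (n : ℕ) :
    (r • g).toLp n = r * g.toLp n := rfl

theorem ext_toLp {f g : WeightedHardy β} (h : ∀ n, f.toLp n = g.toLp n) : f = g :=
  lp.ext (E := fun _ : ℕ => ℂ) (p := 2) (funext h)

theorem norm_toLp_apply_le (f : WeightedHardy β) (n : ℕ) : ‖f.toLp n‖ ≤ ‖f‖ :=
  lp.norm_apply_le_norm (by norm_num) f.toLp n

theorem hasSum_norm_toLp_sq (f : WeightedHardy β) :
    HasSum (fun n => ‖f.toLp n‖ ^ 2) (‖f‖ ^ 2) := by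
  have h := lp.hasSum_norm (p := 2) (by norm_num) f.toLp
  have h2 : ‖f.toLp‖ = ‖f‖ := rfl
  rw [h2] at h
  have e : (2 : ENNReal).toReal = 2 := by norm_num
  rw [e] at h
  simpa only [Real.rpow_two] using h

theorem tsum_enorm_toLp_sq (f : WeightedHardy β) : ∑' n, ‖f.toLp n‖ₑ ^ 2 = ‖f‖ₑ ^ 2 := by
  have h := hasSum_norm_toLp_sq f
  have h2 := ENNReal.ofReal_tsum_of_nonneg (fun n => sq_nonneg ‖f.toLp n‖) h.summable
  rw [h.tsum_eq, ENNReal.ofReal_pow (norm_nonneg _), ofReal_norm] at h2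
  rw [h2]
  refine tsum_congr fun n => ?_
  rw [ENNReal.ofReal_pow (norm_nonneg _), ofReal_norm]

/-- The element with prescribed square-summable sequence `aₙ β(n)`. -/
def ofSeq (β : ℕ → ℝ) (x : ℕ → ℂ) (hx : Summable fun n => ‖x n‖ ^ 2) : WeightedHardy β :=
  (⟨x, by
    refine memℓp_gen ?_
    have e : (2 : ENNReal).toReal = 2 := by norm_num
    rw [e]
    simpa only [Real.rpow_two] using hx⟩ : lp (fun _ : ℕ => ℂ) 2)

@[simp] theorem toLp_ofSeq (x : ℕ → ℂ) (hx : Summable fun n => ‖x n‖ ^ 2) (n : ℕ) :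
    (ofSeq β x hx).toLp n = x n := rfl

/-- The `n`-th coordinate functional `f ↦ aₙ β(n)`. -/
def coord (β : ℕ → ℝ) (n : ℕ) : WeightedHardy β →L[ℂ] ℂ :=
  LinearMap.mkContinuous
    { toFun := fun f => f.toLp n
      map_add' := fun _ _ => rfl
      map_smul' := fun _ _ => rfl } 1 fun f => by
        rw [one_mul]; exact norm_toLp_apply_le f n

@[simp] theorem coord_apply (f : WeightedHardy β) (n : ℕ) : coord β n f = f.toLp n := rfl

/-- The orthonormal basis vector `zᵐ / β(m)`. -/
def unit (β : ℕ → ℝ) (m : ℕ) : WeightedHardy β := 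
  (lp.single (E := fun _ : ℕ => ℂ) 2 m (1 : ℂ) : lp (fun _ : ℕ => ℂ) 2)

theorem toLp_unit (m n : ℕ) : (unit β m).toLp n = if n = m then 1 else 0 := by
  change lp.single (E := fun _ : ℕ => ℂ) 2 m (1 : ℂ) n = _
  rw [lp.single_apply, Pi.single_apply]

theorem hasSum_unit (f : WeightedHardy β) : HasSum (fun m => f.toLp m • unit β m) f := by
  have h : HasSum (fun m => lp.single (E := fun _ : ℕ => ℂ) 2 m (f.toLp m)) f.toLp :=
    lp.hasSum_single (by norm_num) f.toLp
  have e : (fun m => lp.single (E := fun _ : ℕ => ℂ) 2 m (f.toLp m))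
      = fun m => f.toLp m • (unit β m).toLp := by
    funext m
    have h := lp.single_smul (E := fun _ : ℕ => ℂ) 2 m (f.toLp m) (1 : ℂ)
    rwa [smul_eq_mul, mul_one] at h
  rw [e] at h
  exact h

theorem inner_unit_left (f : WeightedHardy β) (n : ℕ) :
    inner ℂ (unit β n) f = f.toLp n := by
  have h := lp.inner_single_left (𝕜 := ℂ) n (1 : ℂ) f.toLp
  simp only [RCLike.inner_apply, map_one, mul_one] at h
  exact h

/-- The matrix entries of an operator in the basis `zᵐ / β(m)`. -/
def entry (L : WeightedHardy β →L[ℂ] WeightedHardy β) (n m : ℕ) : ℂ := (L (unit β m)).toLp n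

theorem hasSum_entry (L : WeightedHardy β →L[ℂ] WeightedHardy β) (f : WeightedHardy β) (n : ℕ) :
    HasSum (fun m => entry L n m * f.toLp m) ((L f).toLp n) := by
  have h := ((coord β n).comp L).hasSum (hasSum_unit f)
  simpa [entry, mul_comm] using h

theorem entry_adjoint (L : WeightedHardy β →L[ℂ] WeightedHardy β) (n m : ℕ) :
    entry (ContinuousLinearMap.adjoint L) n m = star (entry L m n) := by
  rw [entry, ← inner_unit_left, ContinuousLinearMap.adjoint_inner_right, entry,
    ← inner_unit_left, ← inner_conj_symm]
  rfl

theorem entry_sub (L K : WeightedHardy β →L[ℂ] WeightedHardy β) (n m : ℕ) :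
    entry (L - K) n m = entry L n m - entry K n m := rfl

theorem entry_smul (r : ℂ) (K : WeightedHardy β →L[ℂ] WeightedHardy β) (n m : ℕ) :
    entry (r • K) n m = r * entry K n m := rfl

/-- The Schur test bounds the norm of an operator by its matrix entries. -/
theorem norm_le_of_schur (L : WeightedHardy β →L[ℂ] WeightedHardy β) {A B : ℝ≥0}
    (hrow : ∀ n, ∑' m, ‖entry L n m‖ₑ ≤ B) (hcol : ∀ m, ∑' n, ‖entry L n m‖ₑ ≤ A) :
    ‖L‖ ≤ √(B * A) := by
  refine L.opNorm_le_bound (Real.sqrt_nonneg _) fun f => ?_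
  have h1 : ‖L f‖ₑ ^ 2 ≤ B * A * ‖f‖ₑ ^ 2 := by
    rw [← tsum_enorm_toLp_sq, ← tsum_enorm_toLp_sq]
    refine le_trans (ENNReal.tsum_le_tsum fun n => ?_)
      (ENNReal.schur_test hrow hcol fun m => ‖f.toLp m‖ₑ)
    gcongr
    rw [← (hasSum_entry L f n).tsum_eq]
    refine enorm_tsum_le_tsum_enorm.trans_eq ?_
    simp only [enorm_mul]
  have h2 : ‖L f‖ ^ 2 ≤ B * A * ‖f‖ ^ 2 := by
    have := ENNReal.toReal_mono (by finiteness) h1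
    simpa using this
  calc ‖L f‖ = √(‖L f‖ ^ 2) := (Real.sqrt_sq (norm_nonneg _)).symm
    _ ≤ √(B * A * ‖f‖ ^ 2) := Real.sqrt_le_sqrt h2
    _ = _ := by rw [Real.sqrt_mul (by positivity), Real.sqrt_sq (norm_nonneg _)]

/-- The Schur test produces a bounded operator with prescribed matrix entries. -/
theorem exists_entry_eq_of_schur (β : ℕ → ℝ) (T : ℕ → ℕ → ℂ) {A B : ℝ≥0}
    (hrow : ∀ n, ∑' m, ‖T n m‖ₑ ≤ B) (hcol : ∀ m, ∑' n, ‖T n m‖ₑ ≤ A) :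
    ∃ L : WeightedHardy β →L[ℂ] WeightedHardy β, ∀ n m, entry L n m = T n m := by
  have hT : ∀ n, Summable fun m => ‖T n m‖ := fun n => by
    have h : ∑' m, ‖T n m‖ₑ ≠ ∞ := ((hrow n).trans_lt ENNReal.coe_lt_top).ne
    exact tsum_enorm_ne_top_iff_summable_norm.1 h
  have hs : ∀ (f : WeightedHardy β) n, Summable fun m => T n m * f.toLp m := fun f n => by
    refine Summable.of_norm_bounded ((hT n).mul_right ‖f‖) fun m => ?_
    rw [norm_mul]
    gcongr
    exact norm_toLp_apply_le f m
  have hb : ∀ f : WeightedHardy β,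
      ∑' n, ‖∑' m, T n m * f.toLp m‖ₑ ^ 2 ≤ B * A * ‖f‖ₑ ^ 2 := fun f => by
    rw [← tsum_enorm_toLp_sq]
    refine le_trans (ENNReal.tsum_le_tsum fun n => ?_)
      (ENNReal.schur_test hrow hcol fun m => ‖f.toLp m‖ₑ)
    gcongr
    refine enorm_tsum_le_tsum_enorm.trans_eq ?_
    simp only [enorm_mul]
  have hsq : ∀ f : WeightedHardy β, Summable fun n => ‖∑' m, T n m * f.toLp m‖ ^ 2 := fun f => by
    have h : ∑' n, ‖(‖∑' m, T n m * f.toLp m‖ ^ 2 : ℝ)‖ₑ ≠ ∞ := by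
      refine ((le_of_eq (tsum_congr fun n => ?_)).trans (hb f)).trans_lt (by finiteness) |>.ne
      rw [enorm_pow, enorm_norm]
    simpa using tsum_enorm_ne_top_iff_summable_norm.1 h
  let Φ : WeightedHardy β →ₗ[ℂ] WeightedHardy β :=
    { toFun := fun f => ofSeq β (fun n => ∑' m, T n m * f.toLp m) (hsq f)
      map_add' := fun f g => ext_toLp fun n => by
        simp only [toLp_ofSeq, toLp_add, mul_add]
        exact (hs f n).tsum_add (hs g n)
      map_smul' := fun r f => ext_toLp fun n => by
        simp only [toLp_ofSeq, toLp_smul, RingHom.id_apply, ← tsum_mul_left]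
        exact tsum_congr fun m => by ring }
  have hΦ : ∀ f, ‖Φ f‖ ≤ √(B * A) * ‖f‖ := fun f => by
    have h1 : ‖Φ f‖ₑ ^ 2 ≤ B * A * ‖f‖ₑ ^ 2 := by
      rw [← tsum_enorm_toLp_sq]; exact hb f
    have h2 : ‖Φ f‖ ^ 2 ≤ B * A * ‖f‖ ^ 2 := by
      have := ENNReal.toReal_mono (by finiteness) h1
      simpa using this
    calc ‖Φ f‖ = √(‖Φ f‖ ^ 2) := (Real.sqrt_sq (norm_nonneg _)).symm
      _ ≤ √(B * A * ‖f‖ ^ 2) := Real.sqrt_le_sqrt h2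
      _ = _ := by rw [Real.sqrt_mul (by positivity), Real.sqrt_sq (norm_nonneg _)]
  refine ⟨Φ.mkContinuous _ hΦ, fun n m => ?_⟩
  change ∑' k, T n k * (unit β m).toLp k = T n m
  rw [tsum_eq_single m fun k hk => by rw [toLp_unit, if_neg hk, mul_zero], toLp_unit, if_pos rfl,
    mul_one]

/-- An operator with bounded row sums and vanishing column sums is compact. -/
theorem isCompactOperator_of_schur (L : WeightedHardy β →L[ℂ] WeightedHardy β) {B : ℝ≥0}
    (hrow : ∀ n, ∑' m, ‖entry L n m‖ₑ ≤ B)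
    (hcol : Tendsto (fun m => ∑' n, ‖entry L n m‖ₑ) atTop (𝓝 0)) : IsCompactOperator L := by
  -- `P M` is `L` after truncation to the first `M` coordinates. It has finite rank, and `L - P M`
  -- keeps only the columns `m ≥ M`, so the Schur bound makes its norm small.
  let P : ℕ → WeightedHardy β →L[ℂ] WeightedHardy β := fun M =>
    ∑ m ∈ Finset.range M, (coord β m).smulRight (L (unit β m))
  have hP : ∀ M, IsCompactOperator (P M) := fun M => by
    refine Submodule.sum_mem (p := compactOperator (RingHom.id ℂ) _ _)
      (t := Finset.range M) (f := fun m => (coord β m).smulRight (L (unit β m))) fun m _ => ?_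
    have h1 : IsCompactOperator (ContinuousLinearMap.toSpanSingleton ℂ (L (unit β m))) :=
      isCompactOperator_of_locallyCompactSpace_rng _
    exact h1.comp_clm (coord β m)
  have hent : ∀ M n m, entry (L - P M) n m = if m < M then 0 else entry L n m := by
    intro M n m
    have h : (P M (unit β m)).toLp n = if m < M then entry L n m else 0 := by
      have : P M (unit β m) = ∑ k ∈ Finset.range M, (unit β m).toLp k • L (unit β k) := by
        simp [P]
      rw [this]
      simp only [toLp_unit, ite_smul, one_smul, zero_smul]
      rw [Finset.sum_ite_eq']
      simp only [Finset.mem_range]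
      split_ifs <;> rfl
    change (L (unit β m)).toLp n - (P M (unit β m)).toLp n = _
    rw [h]
    split_ifs
    · exact sub_self _
    · exact sub_zero _
  refine isCompactOperator_of_tendsto (l := atTop) (F := P) ?_ (Eventually.of_forall hP)
  rw [tendsto_iff_norm_sub_tendsto_zero, Metric.tendsto_atTop]
  intro ε hε
  obtain ⟨δ, hδ0, hδ⟩ : ∃ δ : ℝ≥0, 0 < δ ∧ √(B * δ) < ε := by
    have : Tendsto (fun δ : ℝ≥0 => √(B * δ)) (𝓝[>] 0) (𝓝 √(B * (0 : ℝ≥0))) :=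
      ((by fun_prop : Continuous fun δ : ℝ≥0 => √(B * δ)).tendsto 0).mono_left
        nhdsWithin_le_nhds
    have h2 := (this.eventually (gt_mem_nhds (by simpa using hε))).and self_mem_nhdsWithin
    obtain ⟨δ, h⟩ := h2.exists
    exact ⟨δ, h.2, h.1⟩
  obtain ⟨M, hM⟩ := eventually_atTop.1
    (hcol.eventually (ge_mem_nhds (ENNReal.coe_pos.2 hδ0)))
  refine ⟨M, fun N hN => ?_⟩
  rw [dist_zero_right, norm_norm, norm_sub_rev]
  refine (norm_le_of_schur _ (A := δ) (B := B) (fun n => ?_) fun m => ?_).trans_lt hδ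
  · refine (ENNReal.tsum_le_tsum fun m => ?_).trans (hrow n)
    rw [hent]; split_ifs <;> simp
  · simp only [hent]
    split_ifs with h
    · simp
    · exact hM m (by omega)

end WeightedHardy

/-! ### The binomial kernel and its row and column sums. -/

/-- The binomial kernel `C(m, n) pⁿ qᵐ⁻ⁿ`. -/
def binomialKernel (p q : ℝ) (n m : ℕ) : ℝ := m.choose n * p ^ n * q ^ (m - n)

/-- The ratio `(m + 1) / (n + 1)` of shifted indices. -/
def indexRatio (n m : ℕ) : ℝ := ((m : ℝ) + 1) / (n + 1)

theorem indexRatio_pos (n m : ℕ) : 0 < indexRatio n m := by unfold indexRatio; positivity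

theorem one_le_indexRatio {n m : ℕ} (h : n ≤ m) : 1 ≤ indexRatio n m := by
  have : (n : ℝ) ≤ m := by exact_mod_cast h
  rw [indexRatio, le_div_iff₀ (by positivity)]
  linarith

section

variable {p q : ℝ}

theorem binomialKernel_nonneg (hp : 0 ≤ p) (hq : 0 ≤ q) (n m : ℕ) :
    0 ≤ binomialKernel p q n m := by unfold binomialKernel; positivity

theorem binomialKernel_eq_zero {n m : ℕ} (h : m < n) : binomialKernel p q n m = 0 := by
  simp [binomialKernel, Nat.choose_eq_zero_of_lt h]

/-- Raising both indices by one multiplies the kernel by a ratio of shifted indices times `p`, so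
each power of `indexRatio` is absorbed by one index shift. The `j`-th shift costs `(j+1)/p`, whence
`k!/pᵏ`. Polynomial factors thus never spoil the plain row and column sums. -/
theorem binomialKernel_mul_indexRatio_pow_le (hp : 0 < p) (hq : 0 ≤ q) (n m k : ℕ) :
    binomialKernel p q n m * indexRatio n m ^ k
      ≤ k.factorial / p ^ k * binomialKernel p q (n + k) (m + k) := by
  induction k with
  | zero => simp
  | succ k ih =>
    have h1 : binomialKernel p q (n + (k + 1)) (m + (k + 1)) * ((n : ℝ) + k + 1)
        = p * (m + k + 1) * binomialKernel p q (n + k) (m + k) := by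
      have h := Nat.add_one_mul_choose_eq (m + k) (n + k)
      have h' : ((m : ℝ) + k + 1) * ((m + k).choose (n + k) : ℝ)
          = ((m + k + 1).choose (n + k + 1) : ℝ) * (n + k + 1) := by exact_mod_cast h
      have e : m + k + 1 - (n + k + 1) = m + k - (n + k) := by omega
      simp only [binomialKernel, ← add_assoc, e, pow_succ p (n + k)]
      linear_combination -(p ^ (n + k) * p * q ^ (m + k - (n + k))) * h'
    have h2 : binomialKernel p q (n + k) (m + k) * indexRatio n m
        ≤ (k + 1) / p * binomialKernel p q (n + (k + 1)) (m + (k + 1)) := by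
      have h3 : binomialKernel p q (n + (k + 1)) (m + (k + 1))
          = p * (m + k + 1) * binomialKernel p q (n + k) (m + k) / ((n : ℝ) + k + 1) := by
        rw [← h1]; field_simp
      have h4 : indexRatio n m ≤ (k + 1) * (m + k + 1) / ((n : ℝ) + k + 1) := by
        rw [indexRatio, div_le_div_iff₀ (by positivity) (by positivity)]
        have hn : (0 : ℝ) ≤ n := n.cast_nonneg
        have hm : (0 : ℝ) ≤ m := m.cast_nonneg
        have hk : (0 : ℝ) ≤ k := k.cast_nonneg
        nlinarith [mul_nonneg hn hk, mul_nonneg hm hk, mul_nonneg (mul_nonneg hn hk) hm,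
          mul_nonneg (mul_nonneg hn hk) hk, mul_nonneg hk hk]
      calc binomialKernel p q (n + k) (m + k) * indexRatio n m
          ≤ binomialKernel p q (n + k) (m + k) * ((k + 1) * (m + k + 1) / ((n : ℝ) + k + 1)) :=
            mul_le_mul_of_nonneg_left h4 (binomialKernel_nonneg hp.le hq _ _)
        _ = _ := by rw [h3]; field_simp
    calc binomialKernel p q n m * indexRatio n m ^ (k + 1)
        = binomialKernel p q n m * indexRatio n m ^ k * indexRatio n m := by ring
      _ ≤ k.factorial / p ^ k * binomialKernel p q (n + k) (m + k) * indexRatio n m := by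
          gcongr; exact (indexRatio_pos n m).le
      _ = k.factorial / p ^ k * (binomialKernel p q (n + k) (m + k) * indexRatio n m) := by ring
      _ ≤ k.factorial / p ^ k *
          ((k + 1) / p * binomialKernel p q (n + (k + 1)) (m + (k + 1))) := by gcongr
      _ = _ := by rw [Nat.factorial_succ]; push_cast; field_simp; ring

theorem sum_binomialKernel (p q : ℝ) (m : ℕ) :
    ∑ n ∈ Finset.range (m + 1), binomialKernel p q n m = (p + q) ^ m := by
  rw [add_pow]
  exact Finset.sum_congr rfl fun n _ => by unfold binomialKernel; ring

theorem tsum_binomialKernel_mul (p q : ℝ) (m : ℕ) (g : ℕ → ℝ) :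
    ∑' n, ENNReal.ofReal (binomialKernel p q n m * g n)
      = ∑ n ∈ Finset.range (m + 1), ENNReal.ofReal (binomialKernel p q n m * g n) :=
  tsum_eq_sum fun n hn => by
    rw [binomialKernel_eq_zero (by simpa using hn), zero_mul, ENNReal.ofReal_zero]

theorem tsum_left_binomialKernel (hp : 0 ≤ p) (hq : 0 ≤ q) (m : ℕ) :
    ∑' n, ENNReal.ofReal (binomialKernel p q n m) = ENNReal.ofReal ((p + q) ^ m) := by
  have h := tsum_binomialKernel_mul p q m fun _ => 1
  simp only [mul_one] at h
  rw [h, ← ENNReal.ofReal_sum_of_nonneg fun n _ => binomialKernel_nonneg hp hq n m,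
    sum_binomialKernel]

/-- The negative binomial series gives `∑ₘ C(m,n) qᵐ⁻ⁿ = (1-q)^(-n-1)`, and `p ≤ 1 - q`. -/
theorem tsum_right_binomialKernel_le (hp : 0 < p) (hq : 0 ≤ q) (hpq : p + q ≤ 1) (n : ℕ) :
    ∑' m, ENNReal.ofReal (binomialKernel p q n m) ≤ ENNReal.ofReal (1 / p) := by
  have h0 := hasSum_choose_mul_geometric_of_norm_lt_one n (r := q)
    (by rw [Real.norm_of_nonneg hq]; linarith)
  have h1 : HasSum (fun m => binomialKernel p q n (m + n)) (p ^ n * (1 / (1 - q) ^ (n + 1))) := by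
    refine (h0.mul_left (p ^ n)).congr_fun fun m => ?_
    rw [binomialKernel, Nat.add_sub_cancel]; ring
  have h2 := (hasSum_nat_add_iff' (f := fun m => binomialKernel p q n m) n).1 (by
    have e : ∑ i ∈ Finset.range n, binomialKernel p q n i = 0 :=
      Finset.sum_eq_zero fun i hi => binomialKernel_eq_zero (Finset.mem_range.1 hi)
    rw [← sub_zero (p ^ n * (1 / (1 - q) ^ (n + 1))), ← e] at h1
    exact h1)
  rw [← ENNReal.ofReal_tsum_of_nonneg (fun m => binomialKernel_nonneg hp.le hq n m) h2.summable,
    h2.tsum_eq]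
  refine ENNReal.ofReal_le_ofReal ?_
  have hq1 : p ≤ 1 - q := by linarith
  calc p ^ n * (1 / (1 - q) ^ (n + 1)) ≤ p ^ n * (1 / p ^ (n + 1)) := by gcongr
    _ = 1 / p := by rw [pow_succ]; field_simp

theorem ofReal_binomialKernel_mul_le (hp : 0 < p) (hq : 0 ≤ q) (n m k : ℕ) :
    ENNReal.ofReal (binomialKernel p q n m * indexRatio n m ^ k)
      ≤ ENNReal.ofReal (k.factorial / p ^ k) *
        ENNReal.ofReal (binomialKernel p q (n + k) (m + k)) := by
  rw [← ENNReal.ofReal_mul (by positivity)]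
  exact ENNReal.ofReal_le_ofReal (binomialKernel_mul_indexRatio_pow_le hp hq n m k)

theorem tsum_left_binomialKernel_mul_le (hp : 0 < p) (hq : 0 ≤ q) (m k : ℕ) :
    ∑' n, ENNReal.ofReal (binomialKernel p q n m * indexRatio n m ^ k)
      ≤ ENNReal.ofReal (k.factorial / p ^ k) * ENNReal.ofReal ((p + q) ^ (m + k)) := by
  refine (ENNReal.tsum_le_tsum fun n => ofReal_binomialKernel_mul_le hp hq n m k).trans ?_
  rw [ENNReal.tsum_mul_left, ← tsum_left_binomialKernel hp.le hq]
  refine mul_le_mul_right ?_ _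
  exact ENNReal.tsum_comp_le_tsum_of_injective (add_left_injective k)
    fun n => ENNReal.ofReal (binomialKernel p q n (m + k))

theorem tsum_right_binomialKernel_mul_le (hp : 0 < p) (hq : 0 ≤ q) (hpq : p + q ≤ 1) (n k : ℕ) :
    ∑' m, ENNReal.ofReal (binomialKernel p q n m * indexRatio n m ^ k)
      ≤ ENNReal.ofReal (k.factorial / p ^ k) * ENNReal.ofReal (1 / p) := by
  refine (ENNReal.tsum_le_tsum fun m => ofReal_binomialKernel_mul_le hp hq n m k).trans ?_
  rw [ENNReal.tsum_mul_left]
  gcongr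
  refine le_trans ?_ (tsum_right_binomialKernel_le hp hq hpq (n + k))
  exact ENNReal.tsum_comp_le_tsum_of_injective (add_left_injective k)
    fun m => ENNReal.ofReal (binomialKernel p q (n + k) m)

/-- The sum is the variance `p(1-p)/m` of a rescaled binomial variable, known from Bernstein
polynomials. -/
theorem tsum_binomialKernel_mul_sq_le (hp : 0 ≤ p) (hq : 0 ≤ q) (hpq : p + q = 1) {m : ℕ}
    (hm : m ≠ 0) :
    ∑' n, ENNReal.ofReal (binomialKernel p q n m * ((n : ℝ) / m - p) ^ 2)
      ≤ ENNReal.ofReal (1 / m) := by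
  rw [tsum_binomialKernel_mul, ← ENNReal.ofReal_sum_of_nonneg fun n _ =>
    mul_nonneg (binomialKernel_nonneg hp hq n m) (sq_nonneg _)]
  refine ENNReal.ofReal_le_ofReal ?_
  have h := bernstein.variance hm ⟨p, hp, by linarith⟩
  have e : ∑ n ∈ Finset.range (m + 1), binomialKernel p q n m * ((n : ℝ) / m - p) ^ 2
      = p * (1 - p) / m := by
    rw [← h, Finset.sum_range]
    refine Finset.sum_congr rfl fun k _ => ?_
    have hq1 : q = 1 - p := by linarith
    rw [bernstein_apply]
    change _ = (p - (k : ℝ) / m) ^ 2 * (m.choose k * p ^ (k : ℕ) * (1 - p) ^ (m - (k : ℕ)))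
    rw [← hq1, binomialKernel]
    ring
  rw [e]
  gcongr
  nlinarith

/-! ### Concentration of the binomial kernel along `n ≈ pm`. -/

/-- The indices `(n, m)` with `n / m → p` and `m → ∞`. -/
def ratioFilter (p : ℝ) : Filter (ℕ × ℕ) :=
  comap (fun x : ℕ × ℕ => (x.1 : ℝ) / x.2) (𝓝 p) ⊓ comap Prod.snd atTop

theorem exists_of_eventually_ratioFilter {P : ℕ × ℕ → Prop} (h : ∀ᶠ x in ratioFilter p, P x) :
    ∃ δ > 0, ∃ M : ℕ, ∀ n m : ℕ, |(n : ℝ) / m - p| < δ → M ≤ m → P (n, m) := by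
  have hb := ((Metric.nhds_basis_ball (x := p)).comap fun x : ℕ × ℕ => (x.1 : ℝ) / x.2).inf
    ((atTop_basis (α := ℕ)).comap (Prod.snd : ℕ × ℕ → ℕ))
  obtain ⟨⟨δ, M⟩, ⟨hδ, -⟩, hsub⟩ := hb.eventually_iff.1 h
  exact ⟨δ, hδ, M, fun n m h1 h2 => hsub ⟨by simpa [Real.dist_eq] using h1, by simpa using h2⟩⟩

theorem tendsto_ratioFilter : Tendsto (fun x : ℕ × ℕ => (x.1 : ℝ) / x.2) (ratioFilter p) (𝓝 p) :=
  tendsto_comap.mono_left inf_le_left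

theorem tendsto_snd_ratioFilter : Tendsto Prod.snd (ratioFilter p) atTop :=
  tendsto_comap.mono_left inf_le_right

theorem tendsto_fst_ratioFilter (hp : 0 < p) : Tendsto Prod.fst (ratioFilter p) atTop := by
  have h1 : Tendsto (fun x : ℕ × ℕ => (x.2 : ℝ)) (ratioFilter p) atTop :=
    tendsto_natCast_atTop_atTop.comp tendsto_snd_ratioFilter
  have h := tendsto_ratioFilter.pos_mul_atTop hp h1
  refine (tendsto_natCast_atTop_iff (R := ℝ)).1 (h.congr' ?_)
  filter_upwards [tendsto_snd_ratioFilter.eventually (eventually_ge_atTop 1)] with x hx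
  have : (x.2 : ℝ) ≠ 0 := by
    have : 1 ≤ x.2 := hx
    positivity
  field_simp

/-- The binomial kernel concentrates along `n ≈ p m`. -/
theorem tendsto_tsum_binomialKernel_mul (hp : 0 < p) (hq : 0 ≤ q) (hpq : p + q = 1)
    {h : ℕ × ℕ → ℝ} {C : ℝ} {k : ℕ} (hC : ∀ n m, n ≤ m → h (n, m) ≤ C * indexRatio n m ^ k)
    (hlim : Tendsto h (ratioFilter p) (𝓝 0)) :
    Tendsto (fun m => ∑' n, ENNReal.ofReal (binomialKernel p q n m * h (n, m))) atTop (𝓝 0) := by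
  wlog hC0 : 0 ≤ C generalizing C
  · refine this (C := 0) (fun n m hnm => (hC n m hnm).trans ?_) le_rfl
    have := (indexRatio_pos n m).le
    gcongr
    linarith
  rw [ENNReal.tendsto_nhds_zero]
  intro ε hε
  obtain ⟨η, hη0, hη⟩ : ∃ η : ℝ≥0, 0 < η ∧ (2 * η : ℝ≥0∞) < ε := by
    obtain ⟨r, hr0, hr⟩ := ENNReal.lt_iff_exists_nnreal_btwn.1 hε
    refine ⟨r / 2, by simpa using hr0, ?_⟩
    have : (2 : ℝ≥0∞) * ((r / 2 : ℝ≥0) : ℝ≥0∞) = r := by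
      rw [← ENNReal.coe_ofNat, ← ENNReal.coe_mul]
      congr 1
      field_simp
    rwa [this]
  obtain ⟨δ, hδ, M, hM⟩ := exists_of_eventually_ratioFilter
    (hlim.eventually (gt_mem_nhds (show (0 : ℝ) < η from hη0)))
  -- The constant `C`, the cost `k!/pᵏ` of absorbing the index ratio, and the Chebyshev factor
  -- `(δ/2)⁻²`.
  set K : ℝ := C * (k.factorial / p ^ k) * (4 / δ ^ 2) with hK
  have hK0 : 0 ≤ K := by positivity
  -- Where `n/m` is within `δ` of `p`, `h` is below `η`. Elsewhere the growth bound is absorbed by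
  -- the shift to `(n+k, m+k)` and the result is multiplied by a quantity at least `1`, as in
  -- Chebyshev's inequality.
  have hpt : ∀ᶠ m : ℕ in atTop, ∀ n, ENNReal.ofReal (binomialKernel p q n m * h (n, m))
      ≤ ENNReal.ofReal η * ENNReal.ofReal (binomialKernel p q n m) + ENNReal.ofReal K *
        ENNReal.ofReal (binomialKernel p q (n + k) (m + k) *
          (((n + k : ℕ) : ℝ) / (m + k : ℕ) - p) ^ 2) := by
    filter_upwards [eventually_ge_atTop M, eventually_ge_atTop 1,
      eventually_ge_atTop ⌈2 * (k * (1 + δ / 2)) / δ⌉₊] with m hmM hm1 hm2 n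
    have hb0 := binomialKernel_nonneg hp.le hq n m
    have hb1 := binomialKernel_nonneg hp.le hq (n + k) (m + k)
    rw [← ENNReal.ofReal_mul (by positivity), ← ENNReal.ofReal_mul hK0,
      ← ENNReal.ofReal_add (by positivity) (by positivity)]
    refine ENNReal.ofReal_le_ofReal ?_
    have hm0 : (0 : ℝ) < m := by exact_mod_cast hm1
    by_cases hnear : |(n : ℝ) / m - p| < δ
    · have h1 := (hM n m hnear hmM).le
      have : 0 ≤ K * (binomialKernel p q (n + k) (m + k) *
          (((n + k : ℕ) : ℝ) / (m + k : ℕ) - p) ^ 2) := by positivity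
      nlinarith [mul_le_mul_of_nonneg_left h1 hb0]
    · rcases lt_or_ge m n with hnm | hnm
      · rw [binomialKernel_eq_zero hnm, zero_mul]
        positivity
      have hfar : 1 ≤ 4 / δ ^ 2 * (((n + k : ℕ) : ℝ) / (m + k : ℕ) - p) ^ 2 := by
        -- The threshold on `m` ensures that shifting both indices by `k` lowers the distance to `p`
        -- from `δ` to no less than `δ/2`.
        have h2 : 2 * (k * (1 + δ / 2)) ≤ δ * m := by
          have := Nat.ceil_le.1 hm2
          rw [div_le_iff₀ hδ] at this
          linarith
        have h3 : δ * m ≤ |(n : ℝ) - p * m| := by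
          have e : (n : ℝ) - p * m = ((n : ℝ) / m - p) * m := by field_simp
          rw [e, abs_mul, abs_of_pos hm0]
          exact mul_le_mul_of_nonneg_right (not_lt.1 hnear) hm0.le
        have h4 : δ / 2 * (m + k) ≤ |((n + k : ℝ)) - p * (m + k)| := by
          have e : (n : ℝ) - p * m = ((n + k : ℝ) - p * (m + k)) - k * (1 - p) := by ring
          have h5 : |(n : ℝ) - p * m| ≤ |((n + k : ℝ)) - p * (m + k)| + |k * (1 - p)| := by
            rw [e]; exact abs_sub _ _
          have h6 : |k * (1 - p)| ≤ k := by
            rw [abs_of_nonneg (by have : 0 ≤ 1 - p := by linarith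
                                  positivity)]
            have : (0 : ℝ) ≤ k := k.cast_nonneg
            nlinarith
          nlinarith
        have h7 : δ / 2 ≤ |((n + k : ℕ) : ℝ) / (m + k : ℕ) - p| := by
          have hmk : (0 : ℝ) < m + k := by positivity
          have e : ((n + k : ℕ) : ℝ) / (m + k : ℕ) - p
              = ((n + k : ℝ) - p * (m + k)) / (m + k) := by
            push_cast; field_simp
          rw [e, abs_div, abs_of_pos hmk, le_div_iff₀ hmk]
          exact h4
        have h8 : (δ / 2) ^ 2 ≤ (((n + k : ℕ) : ℝ) / (m + k : ℕ) - p) ^ 2 := by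
          rw [← sq_abs (((n + k : ℕ) : ℝ) / (m + k : ℕ) - p)]
          gcongr
        rw [div_mul_eq_mul_div, le_div_iff₀ (by positivity)]
        linarith
      have h1 := binomialKernel_mul_indexRatio_pow_le hp hq n m k
      calc binomialKernel p q n m * h (n, m)
          ≤ binomialKernel p q n m * (C * indexRatio n m ^ k) := by
            gcongr; exact hC n m hnm
        _ = C * (binomialKernel p q n m * indexRatio n m ^ k) := by ring
        _ ≤ C * (k.factorial / p ^ k * binomialKernel p q (n + k) (m + k)) := by gcongr
        _ ≤ C * (k.factorial / p ^ k * binomialKernel p q (n + k) (m + k)) *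
            (4 / δ ^ 2 * (((n + k : ℕ) : ℝ) / (m + k : ℕ) - p) ^ 2) :=
            le_mul_of_one_le_right (by positivity) hfar
        _ = K * (binomialKernel p q (n + k) (m + k) *
            (((n + k : ℕ) : ℝ) / (m + k : ℕ) - p) ^ 2) := by rw [hK]; ring
        _ ≤ _ := le_add_of_nonneg_left (by positivity)
  have hsmall : Tendsto (fun m : ℕ => ENNReal.ofReal K * ENNReal.ofReal (1 / ((m + k : ℕ) : ℝ)))
      atTop (𝓝 0) := by
    have h1 : Tendsto (fun m : ℕ => ENNReal.ofReal (1 / ((m + k : ℕ) : ℝ))) atTop (𝓝 0) := by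
      rw [← ENNReal.ofReal_zero]
      exact ENNReal.tendsto_ofReal
        ((tendsto_add_atTop_iff_nat k).2 (tendsto_one_div_atTop_nhds_zero_nat (𝕜 := ℝ)))
    have := ENNReal.Tendsto.const_mul (a := ENNReal.ofReal K) h1 (Or.inr ENNReal.ofReal_ne_top)
    simpa using this
  filter_upwards [hpt, ENNReal.tendsto_nhds_zero.1 hsmall η (by simpa using hη0),
    eventually_ge_atTop 1] with m hm hs hm1
  refine le_trans ?_ hη.le
  calc ∑' n, ENNReal.ofReal (binomialKernel p q n m * h (n, m))
      ≤ ∑' n, (ENNReal.ofReal η * ENNReal.ofReal (binomialKernel p q n m) + ENNReal.ofReal K *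
        ENNReal.ofReal (binomialKernel p q (n + k) (m + k) *
          (((n + k : ℕ) : ℝ) / (m + k : ℕ) - p) ^ 2)) := ENNReal.tsum_le_tsum hm
    _ ≤ ENNReal.ofReal η * 1 + ENNReal.ofReal K * ENNReal.ofReal (1 / ((m + k : ℕ) : ℝ)) := by
        rw [ENNReal.tsum_add, ENNReal.tsum_mul_left, ENNReal.tsum_mul_left,
          tsum_left_binomialKernel hp.le hq, hpq, one_pow, ENNReal.ofReal_one]
        gcongr
        refine le_trans ?_ (tsum_binomialKernel_mul_sq_le hp.le hq hpq (m := m + k) (by omega))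
        exact ENNReal.tsum_comp_le_tsum_of_injective (add_left_injective k) fun n =>
          ENNReal.ofReal (binomialKernel p q n (m + k) * ((n : ℝ) / (m + k : ℕ) - p) ^ 2)
    _ ≤ 2 * η := by
        rw [mul_one, two_mul, ENNReal.ofReal_coe_nnreal]
        gcongr

end

/-! ### Weights of power type. -/

/-- Positive weights with `β(n) ~ ℓ nᵗ` for some `ℓ > 0`. -/
structure IsPowerWeight (β : ℕ → ℝ) (t ℓ : ℝ) : Prop where
  pos : ∀ n, 0 < β n
  limit_pos : 0 < ℓ
  tendsto : Tendsto (fun n : ℕ => β n / (n : ℝ) ^ t) atTop (𝓝 ℓ)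

namespace IsPowerWeight

variable {β : ℕ → ℝ} {t ℓ : ℝ}

/-- With `(n+1)ᵗ` in place of `nᵗ` the quotient is positive at `n = 0` as well, so two-sided bounds
hold for every `n`. -/
theorem tendsto_succ (hβ : IsPowerWeight β t ℓ) :
    Tendsto (fun n : ℕ => β n / ((n : ℝ) + 1) ^ t) atTop (𝓝 ℓ) := by
  have h1 : Tendsto (fun n : ℕ => ((n : ℝ) / (n + 1)) ^ t) atTop (𝓝 1) := by
    have h := (tendsto_natCast_div_add_atTop (𝕜 := ℝ) 1).rpow_const (p := t)
      (Or.inl one_ne_zero)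
    simpa using h
  have h2 := hβ.tendsto.mul h1
  rw [mul_one] at h2
  refine h2.congr' ?_
  filter_upwards [eventually_ge_atTop 1] with n hn
  have hn0 : (0 : ℝ) < n := by exact_mod_cast hn
  rw [Real.div_rpow hn0.le (by positivity)]
  have : (0 : ℝ) < (n : ℝ) ^ t := by positivity
  field_simp

theorem exists_bounds (hβ : IsPowerWeight β t ℓ) :
    ∃ c > 0, ∃ C > 0, ∀ n : ℕ, c * ((n : ℝ) + 1) ^ t ≤ β n ∧ β n ≤ C * ((n : ℝ) + 1) ^ t := by
  obtain ⟨U, hU⟩ := hβ.tendsto_succ.bddAbove_range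
  obtain ⟨V, hV⟩ := (hβ.tendsto_succ.inv₀ hβ.limit_pos.ne').bddAbove_range
  have hg : ∀ n : ℕ, 0 < β n / ((n : ℝ) + 1) ^ t := fun n => by
    have := hβ.pos n
    positivity
  have hU' : ∀ n : ℕ, β n / ((n : ℝ) + 1) ^ t ≤ U := fun n => hU ⟨n, rfl⟩
  have hV' : ∀ n : ℕ, (β n / ((n : ℝ) + 1) ^ t)⁻¹ ≤ V := fun n => hV ⟨n, rfl⟩
  have hU0 : 0 < U := (hg 0).trans_le (hU' 0)
  have hV0 : 0 < V := (inv_pos.2 (hg 0)).trans_le (hV' 0)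
  refine ⟨V⁻¹, inv_pos.2 hV0, U, hU0, fun n => ⟨?_, ?_⟩⟩
  · rw [← le_div_iff₀ (by positivity)]
    exact inv_le_of_inv_le₀ (hg n) (hV' n)
  · rw [← div_le_iff₀ (by positivity)]
    exact hU' n

/-- Both quotients are needed: one occurs in the matrix of `C_σ`, the other in that of `C_φ*`. Any
integer `k ≥ |t|` serves for both. -/
theorem exists_ratio_le (hβ : IsPowerWeight β t ℓ) :
    ∃ C > 0, ∃ k : ℕ, ∀ n m, n ≤ m →
      β n / β m ≤ C * indexRatio n m ^ k ∧ β m / β n ≤ C * indexRatio n m ^ k := by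
  obtain ⟨c, hc, C, hC, h⟩ := hβ.exists_bounds
  obtain ⟨k, hk⟩ := exists_nat_ge |t|
  refine ⟨C / c, by positivity, k, fun n m hnm => ?_⟩
  have hρ := one_le_indexRatio hnm
  have hρ0 := indexRatio_pos n m
  have e : ((m : ℝ) + 1) ^ t = indexRatio n m ^ t * ((n : ℝ) + 1) ^ t := by
    rw [← Real.mul_rpow hρ0.le (by positivity), indexRatio]
    congr 1
    field_simp
  have h1 : indexRatio n m ^ t ≤ indexRatio n m ^ k := by
    rw [← Real.rpow_natCast]
    exact Real.rpow_le_rpow_of_exponent_le hρ ((le_abs_self t).trans hk)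
  have h2 : 1 ≤ indexRatio n m ^ k * indexRatio n m ^ t := by
    rw [← Real.rpow_natCast, ← Real.rpow_add hρ0]
    exact Real.one_le_rpow hρ (by linarith [neg_abs_le t])
  have hX : (0 : ℝ) < ((n : ℝ) + 1) ^ t := by positivity
  constructor
  · rw [div_le_iff₀ (hβ.pos m)]
    calc β n ≤ C * ((n : ℝ) + 1) ^ t := (h n).2
      _ ≤ C * ((n : ℝ) + 1) ^ t * (indexRatio n m ^ k * indexRatio n m ^ t) :=
          le_mul_of_one_le_right (by positivity) h2
      _ = C / c * indexRatio n m ^ k * (c * ((m : ℝ) + 1) ^ t) := by rw [e]; field_simp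
      _ ≤ _ := by
          gcongr
          exact (h m).1
  · rw [div_le_iff₀ (hβ.pos n)]
    calc β m ≤ C * ((m : ℝ) + 1) ^ t := (h m).2
      _ = C * (indexRatio n m ^ t * ((n : ℝ) + 1) ^ t) := by rw [e]
      _ ≤ C * (indexRatio n m ^ k * ((n : ℝ) + 1) ^ t) := by gcongr
      _ = C / c * indexRatio n m ^ k * (c * ((n : ℝ) + 1) ^ t) := by field_simp
      _ ≤ _ := by
          gcongr
          exact (h n).1

end IsPowerWeight

/-! ### Point evaluations, and operators recognised on basis vectors. -/

namespace WeightedHardy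

variable {β : ℕ → ℝ} {t ℓ : ℝ}

/-- The partial sums are continuous functionals converging pointwise, so by Banach–Steinhaus the
limit is continuous. Identities between values of operators can then be checked on basis vectors. -/
theorem exists_eval_clm (hβ : IsPowerWeight β t ℓ) {z : ℂ} (hz : z ∈ ball (0 : ℂ) 1) :
    ∃ ev : WeightedHardy β →L[ℂ] ℂ, ∀ f, ev f = f.eval z := by
  let g : ℕ → WeightedHardy β →L[ℂ] ℂ := fun N =>
    ∑ n ∈ Finset.range N, (z ^ n / (β n : ℂ)) • coord β n
  have hg : Tendsto (fun N f => g N f) atTop (𝓝 fun f : WeightedHardy β => f.eval z) := by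
    refine tendsto_pi_nhds.2 fun f => ?_
    have h := (hasSum_eval hβ.pos hβ.limit_pos hβ.tendsto f hz).tendsto_sum_nat
    refine h.congr fun N => ?_
    simp only [g, sum_apply, smul_apply, coord_apply,
      coeff, smul_eq_mul]
    exact Finset.sum_congr rfl fun n _ => by ring
  exact ⟨continuousLinearMapOfTendsto g hg, fun f => rfl⟩

theorem coeff_unit (m n : ℕ) : (unit β m).coeff n = if n = m then (β m : ℂ)⁻¹ else 0 := by
  rw [coeff, toLp_unit]
  split_ifs with h
  · rw [h, one_div]
  · rw [zero_div]

theorem eval_unit (m : ℕ) (z : ℂ) : (unit β m).eval z = z ^ m / (β m : ℂ) := by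
  rw [eval, tsum_eq_single m fun n hn => by rw [coeff_unit, if_neg hn, zero_mul], coeff_unit,
    if_pos rfl]
  ring

theorem clm_ext_unit {E : Type*} [NormedAddCommGroup E] [NormedSpace ℂ E]
    {L K : WeightedHardy β →L[ℂ] E} (h : ∀ m, L (unit β m) = K (unit β m)) : L = K := by
  ext f
  have h1 := L.hasSum (hasSum_unit f)
  have h2 := K.hasSum (hasSum_unit f)
  simp only [map_smul, h] at h1 h2
  exact h1.unique h2

/-- The matrix entries `τ n m * β n / β m` come from the power series `∑ τ n m zⁿ`. -/
theorem eval_unit_of_entry (hβ : IsPowerWeight β t ℓ)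
    {T : WeightedHardy β →L[ℂ] WeightedHardy β} {τ : ℕ → ℕ → ℂ}
    (hT : ∀ n m, entry T n m = τ n m * (β n / β m)) {m : ℕ} {z w : ℂ}
    (h : HasSum (fun n => τ n m * z ^ n) w) : (T (unit β m)).eval z = w / β m := by
  rw [eval, ← (h.div_const (β m : ℂ)).tsum_eq]
  refine tsum_congr fun n => ?_
  have hn : (β n : ℂ) ≠ 0 := by exact_mod_cast (hβ.pos n).ne'
  have := hT n m
  rw [entry] at this
  rw [coeff, this]
  field_simp

theorem isCompositionOperator_of_unit (hβ : IsPowerWeight β t ℓ) {φ : ℂ → ℂ}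
    (hφ : MapsTo φ (ball 0 1) (ball 0 1)) {T : WeightedHardy β →L[ℂ] WeightedHardy β}
    (h : ∀ m, ∀ z ∈ ball (0 : ℂ) 1, (T (unit β m)).eval z = φ z ^ m / β m) :
    IsCompositionOperator φ T := by
  refine ⟨hφ, fun f z hz => ?_⟩
  obtain ⟨ev, hev⟩ := exists_eval_clm hβ hz
  obtain ⟨ev', hev'⟩ := exists_eval_clm hβ (hφ hz)
  have : ev.comp T = ev' := clm_ext_unit fun m => by
    rw [ContinuousLinearMap.comp_apply, hev, hev', h m z hz, eval_unit]
  rw [← hev, ← hev', ← this, ContinuousLinearMap.comp_apply]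

theorem isMultiplicationOperator_of_unit (hβ : IsPowerWeight β t ℓ) {G : ℂ → ℂ}
    {T : WeightedHardy β →L[ℂ] WeightedHardy β}
    (h : ∀ m, ∀ z ∈ ball (0 : ℂ) 1, (T (unit β m)).eval z = G z * (z ^ m / β m)) :
    IsMultiplicationOperator G T := by
  intro f z hz
  obtain ⟨ev, hev⟩ := exists_eval_clm hβ hz
  have : ev.comp T = G z • ev := clm_ext_unit fun m => by
    rw [ContinuousLinearMap.comp_apply, smul_apply, hev, hev, h m z hz,
      eval_unit, smul_eq_mul]
  rw [← hev, ← hev, ← ContinuousLinearMap.comp_apply, this, smul_apply,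
    smul_eq_mul]

section kernel

variable {p q : ℝ}

theorem enorm_le_of_norm_le_mul {x : ℂ} {D y : ℝ} (hD : 0 ≤ D) (h : ‖x‖ ≤ D * y) :
    ‖x‖ₑ ≤ ENNReal.ofReal D * ENNReal.ofReal y := by
  rw [← ofReal_norm, ← ENNReal.ofReal_mul hD]
  exact ENNReal.ofReal_le_ofReal h

theorem tsum_row_le_of_kernel (hp : 0 < p) (hq : 0 ≤ q) (hpq : p + q ≤ 1) {T : ℕ → ℕ → ℂ}
    {D : ℝ} {k : ℕ} (hD : 0 ≤ D)
    (hT : ∀ n m, ‖T n m‖ ≤ D * (binomialKernel p q n m * indexRatio n m ^ k)) (n : ℕ) :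
    ∑' m, ‖T n m‖ₑ ≤ (D.toNNReal * ((k.factorial / p ^ k).toNNReal * (1 / p).toNNReal) : ℝ≥0) := by
  refine (ENNReal.tsum_le_tsum fun m => enorm_le_of_norm_le_mul hD (hT n m)).trans ?_
  rw [ENNReal.tsum_mul_left, ENNReal.coe_mul, ENNReal.coe_mul]
  exact mul_le_mul_right (tsum_right_binomialKernel_mul_le hp hq hpq n k) _

theorem tsum_col_le_of_kernel (hp : 0 < p) (hq : 0 ≤ q) {T : ℕ → ℕ → ℂ}
    {D : ℝ} {k : ℕ} (hD : 0 ≤ D)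
    (hT : ∀ n m, ‖T n m‖ ≤ D * (binomialKernel p q n m * indexRatio n m ^ k)) (m : ℕ) :
    ∑' n, ‖T n m‖ₑ ≤
      ENNReal.ofReal (D * (k.factorial / p ^ k)) * ENNReal.ofReal ((p + q) ^ (m + k)) := by
  refine (ENNReal.tsum_le_tsum fun n => enorm_le_of_norm_le_mul hD (hT n m)).trans ?_
  rw [ENNReal.tsum_mul_left, ENNReal.ofReal_mul hD, mul_assoc]
  exact mul_le_mul_right (tsum_left_binomialKernel_mul_le hp hq m k) _

theorem exists_entry_eq_of_kernel (β : ℕ → ℝ) (hp : 0 < p) (hq : 0 ≤ q) (hpq : p + q ≤ 1)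
    {T : ℕ → ℕ → ℂ} {D : ℝ} {k : ℕ} (hD : 0 ≤ D)
    (hT : ∀ n m, ‖T n m‖ ≤ D * (binomialKernel p q n m * indexRatio n m ^ k)) :
    ∃ L : WeightedHardy β →L[ℂ] WeightedHardy β, ∀ n m, entry L n m = T n m := by
  refine exists_entry_eq_of_schur β T (A := (D * (k.factorial / p ^ k)).toNNReal)
    (tsum_row_le_of_kernel hp hq hpq hD hT) fun m => ?_
  refine (tsum_col_le_of_kernel hp hq hD hT m).trans ?_
  calc _ ≤ ENNReal.ofReal (D * (k.factorial / p ^ k)) * 1 := by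
        gcongr
        rw [ENNReal.ofReal_le_one]
        exact pow_le_one₀ (by positivity) hpq
    _ = _ := by rw [mul_one]; rfl

end kernel

/-! ### The matrices of `C_σ`, `C_φ` and the shift. -/

/-- The matrix of `f ↦ f(Pz + Q)` in Taylor coefficients. -/
def affineCoeff (P Q : ℂ) (n m : ℕ) : ℂ := m.choose n * P ^ n * Q ^ (m - n)

/-- The matrix of `f ↦ f(Pz / (1 - Qz))` in Taylor coefficients. -/
def fractionalCoeff (P Q : ℂ) (n m : ℕ) : ℂ :=
  (if n = 0 then 1 else (m : ℂ) / n) * (n.choose m * P ^ m * Q ^ (n - m))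

theorem norm_affineCoeff (P Q : ℂ) (n m : ℕ) :
    ‖affineCoeff P Q n m‖ = binomialKernel ‖P‖ ‖Q‖ n m := by
  simp [affineCoeff, binomialKernel]

theorem hasSum_affineCoeff (P Q z : ℂ) (m : ℕ) :
    HasSum (fun n => affineCoeff P Q n m * z ^ n) ((P * z + Q) ^ m) := by
  rw [add_pow]
  have e : ∀ n ∈ Finset.range (m + 1), (P * z) ^ n * Q ^ (m - n) * (m.choose n : ℂ)
      = affineCoeff P Q n m * z ^ n := fun n _ => by rw [affineCoeff, mul_pow]; ring
  rw [Finset.sum_congr rfl e]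
  refine hasSum_sum_of_ne_finset_zero fun n hn => ?_
  rw [affineCoeff, Nat.choose_eq_zero_of_lt (by simpa using hn)]
  simp

/-- The expansion produces `C(n-1,m-1)`. Writing it as `(m/n) C(n,m)` exhibits the same binomial
kernel as for `C_σ`. The value `1` at `n = 0` matters only for `m = 0`, the constant function. -/
theorem hasSum_fractionalCoeff {P Q z : ℂ} (hQ : ‖Q * z‖ < 1) (m : ℕ) :
    HasSum (fun n => fractionalCoeff P Q n m * z ^ n) ((P * z / (1 - Q * z)) ^ m) := by
  rcases m with _ | m
  · rw [pow_zero]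
    convert hasSum_single (f := fun n => fractionalCoeff P Q n 0 * z ^ n) 0 fun n hn => ?_ using 1
    · simp [fractionalCoeff]
    · simp [fractionalCoeff, hn]
  · have h0 := (hasSum_choose_mul_geometric_of_norm_lt_one m hQ).mul_left ((P * z) ^ (m + 1))
    have h1 : HasSum (fun j => fractionalCoeff P Q (j + (m + 1)) (m + 1) * z ^ (j + (m + 1)))
        ((P * z / (1 - Q * z)) ^ (m + 1)) := by
      rw [div_pow, div_eq_mul_one_div]
      refine h0.congr_fun fun j => ?_
      have h := Nat.add_one_mul_choose_eq (j + m) m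
      have h' : ((j : ℂ) + m + 1) * ((j + m).choose m : ℂ)
          = ((j + m + 1).choose (m + 1) : ℂ) * (m + 1) := by exact_mod_cast h
      have hne : ((j : ℂ) + m + 1) ≠ 0 := by exact_mod_cast (Nat.succ_ne_zero (j + m))
      have h2 : ((m : ℂ) + 1) / (j + m + 1) * ((j + m + 1).choose (m + 1) : ℂ)
          = ((j + m).choose m : ℂ) := by
        field_simp
        linear_combination -h'
      rw [fractionalCoeff, if_neg (by omega), Nat.add_sub_cancel, ← add_assoc, mul_pow, mul_pow,
        ← h2]
      push_cast
      ring
    refine (hasSum_nat_add_iff' (f := fun n => fractionalCoeff P Q n (m + 1) * z ^ n)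
      (m + 1)).1 ?_
    rwa [Finset.sum_eq_zero, sub_zero]
    intro n hn
    rw [fractionalCoeff, Nat.choose_eq_zero_of_lt (by simpa using hn)]
    simp

/-- The factor `m/n` is at most `1` wherever the binomial coefficient does not vanish. -/
theorem norm_fractionalCoeff_le (P Q : ℂ) (n m : ℕ) :
    ‖fractionalCoeff P Q n m‖ ≤ binomialKernel ‖P‖ ‖Q‖ m n := by
  rcases lt_or_ge n m with h | h
  · rw [fractionalCoeff, Nat.choose_eq_zero_of_lt h, binomialKernel_eq_zero h]
    simp
  · rw [fractionalCoeff, norm_mul]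
    have e : ‖(n.choose m * P ^ m * Q ^ (n - m) : ℂ)‖ = binomialKernel ‖P‖ ‖Q‖ m n := by
      simp [binomialKernel]
    rw [e]
    refine mul_le_of_le_one_left (binomialKernel_nonneg (norm_nonneg _) (norm_nonneg _) _ _) ?_
    split_ifs with hn
    · simp
    · have : (0 : ℝ) < n := by positivity
      rw [norm_div, Complex.norm_natCast, Complex.norm_natCast, div_le_one this]
      exact_mod_cast h

theorem norm_ofReal_div (hβ : IsPowerWeight β t ℓ) (n m : ℕ) :
    ‖(β n / β m : ℂ)‖ = β n / β m := by
  rw [norm_div, Complex.norm_real, Complex.norm_real, Real.norm_of_nonneg (hβ.pos n).le,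
    Real.norm_of_nonneg (hβ.pos m).le]

theorem binomialKernel_mul_le {p q : ℝ} (hp : 0 ≤ p) (hq : 0 ≤ q) {n m : ℕ} {x y : ℝ}
    (h : n ≤ m → x ≤ y) : binomialKernel p q n m * x ≤ binomialKernel p q n m * y := by
  rcases lt_or_ge m n with hnm | hnm
  · simp [binomialKernel_eq_zero hnm]
  · exact mul_le_mul_of_nonneg_left (h hnm) (binomialKernel_nonneg hp hq n m)

theorem exists_affine (hβ : IsPowerWeight β t ℓ) {P Q : ℂ} (hP : P ≠ 0) (hPQ : ‖P‖ + ‖Q‖ ≤ 1) :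
    ∃ L : WeightedHardy β →L[ℂ] WeightedHardy β,
      ∀ n m, entry L n m = affineCoeff P Q n m * (β n / β m) := by
  obtain ⟨C, hC, k, h⟩ := hβ.exists_ratio_le
  refine exists_entry_eq_of_kernel β (norm_pos_iff.2 hP) (norm_nonneg Q) hPQ (D := C) (k := k)
    hC.le fun n m => ?_
  rw [norm_mul, norm_affineCoeff, norm_ofReal_div hβ, mul_left_comm C]
  exact binomialKernel_mul_le (norm_nonneg _) (norm_nonneg _) fun hnm => (h n m hnm).1

theorem exists_fractional (hβ : IsPowerWeight β t ℓ) {P Q : ℂ} (hP : P ≠ 0)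
    (hPQ : ‖P‖ + ‖Q‖ ≤ 1) :
    ∃ L : WeightedHardy β →L[ℂ] WeightedHardy β,
      ∀ n m, entry L n m = fractionalCoeff P Q n m * (β n / β m) := by
  obtain ⟨C, hC, k, h⟩ := hβ.exists_ratio_le
  -- This matrix is lower triangular while the kernel estimates are for upper triangular ones, so
  -- the adjoint is constructed first.
  obtain ⟨L, hL⟩ := exists_entry_eq_of_kernel β (norm_pos_iff.2 hP) (norm_nonneg Q) hPQ (D := C)
    (k := k) (T := fun n m => star (fractionalCoeff P Q m n * (β m / β n))) hC.le fun n m => by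
      rw [norm_star, norm_mul, norm_ofReal_div hβ, mul_left_comm C]
      refine (mul_le_mul_of_nonneg_right (norm_fractionalCoeff_le P Q m n)
        (div_pos (hβ.pos m) (hβ.pos n)).le).trans ?_
      exact binomialKernel_mul_le (norm_nonneg _) (norm_nonneg _) fun hnm => (h n m hnm).2
  exact ⟨ContinuousLinearMap.adjoint L, fun n m => by rw [entry_adjoint, hL, star_star]⟩

theorem isCompositionOperator_affine (hβ : IsPowerWeight β t ℓ) {P Q : ℂ}
    {L : WeightedHardy β →L[ℂ] WeightedHardy β}
    (hL : ∀ n m, entry L n m = affineCoeff P Q n m * (β n / β m)) {σ : ℂ → ℂ}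
    (hσ : ∀ z ∈ ball (0 : ℂ) 1, σ z = P * z + Q) (hmaps : MapsTo σ (ball 0 1) (ball 0 1)) :
    IsCompositionOperator σ L :=
  isCompositionOperator_of_unit hβ hmaps fun m z hz => by
    rw [hσ z hz]
    exact eval_unit_of_entry hβ hL (hasSum_affineCoeff P Q z m)

theorem isCompositionOperator_fractional (hβ : IsPowerWeight β t ℓ) {P Q : ℂ} (hQ : ‖Q‖ ≤ 1)
    {L : WeightedHardy β →L[ℂ] WeightedHardy β}
    (hL : ∀ n m, entry L n m = fractionalCoeff P Q n m * (β n / β m)) {φ : ℂ → ℂ}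
    (hφ : ∀ z ∈ ball (0 : ℂ) 1, φ z = P * z / (1 - Q * z))
    (hmaps : MapsTo φ (ball 0 1) (ball 0 1)) :
    IsCompositionOperator φ L :=
  isCompositionOperator_of_unit hβ hmaps fun m z hz => by
    rw [hφ z hz]
    refine eval_unit_of_entry hβ hL (hasSum_fractionalCoeff ?_ m)
    rw [norm_mul]
    have hz1 : ‖z‖ < 1 := by simpa using hz
    nlinarith [norm_nonneg z]

/-- The shift `f ↦ z f`. -/
theorem exists_shift (hβ : IsPowerWeight β t ℓ) :
    ∃ S : WeightedHardy β →L[ℂ] WeightedHardy β, IsMultiplicationOperator (fun z => z) S ∧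
      ∀ n m, entry S n m = (if n = m + 1 then 1 else 0) * (β n / β m) := by
  obtain ⟨C, hC, k, h⟩ := hβ.exists_ratio_le
  have hb : ∀ n, ‖(β (n + 1) / β n : ℂ)‖ₑ ≤ ((C * 2 ^ k).toNNReal : ℝ≥0) := fun n => by
    rw [← ofReal_norm]
    refine ENNReal.ofReal_le_ofReal ?_
    rw [norm_ofReal_div hβ]
    refine (h n (n + 1) (by omega)).2.trans ?_
    have : indexRatio n (n + 1) ≤ 2 := by
      rw [indexRatio, div_le_iff₀ (by positivity)]
      push_cast
      linarith [(n.cast_nonneg : (0 : ℝ) ≤ n)]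
    have := indexRatio_pos n (n + 1)
    gcongr
  obtain ⟨S, hS⟩ := exists_entry_eq_of_schur β
    (fun n m => (if n = m + 1 then 1 else 0) * (β n / β m : ℂ))
    (A := (C * 2 ^ k).toNNReal) (B := (C * 2 ^ k).toNNReal) (fun n => by
      rcases n with _ | n
      · simp
      · rw [tsum_eq_single n fun m hm => by rw [if_neg (by omega), zero_mul, enorm_zero],
          if_pos rfl, one_mul]
        exact hb n) (fun m => by
      rw [tsum_eq_single (m + 1) fun n hn => by rw [if_neg hn, zero_mul, enorm_zero],
          if_pos rfl, one_mul]
      exact hb m)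
  refine ⟨S, isMultiplicationOperator_of_unit hβ fun m z _ => ?_, hS⟩
  rw [eval_unit_of_entry hβ (τ := fun n m => if n = m + 1 then 1 else 0) (w := z * z ^ m) hS,
    mul_div_assoc]
  convert hasSum_single (m + 1) fun n hn => ?_ using 1
  · simp [pow_succ']
  · rw [if_neg hn, zero_mul]

end WeightedHardy

/-! ### Limits of weight ratios. -/

namespace IsPowerWeight

variable {β : ℕ → ℝ} {t ℓ : ℝ}

theorem tendsto_ratio (hβ : IsPowerWeight β t ℓ) {p : ℝ} (hp : 0 < p) :
    Tendsto (fun x : ℕ × ℕ => β x.1 / β x.2) (ratioFilter p) (𝓝 (p ^ t)) := by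
  have h1 := hβ.tendsto.comp (tendsto_fst_ratioFilter hp)
  have h2 := hβ.tendsto.comp (tendsto_snd_ratioFilter (p := p))
  have h3 := (tendsto_ratioFilter (p := p)).rpow_const (p := t) (Or.inl hp.ne')
  have h4 := (h1.div h2 hβ.limit_pos.ne').mul h3
  rw [div_self hβ.limit_pos.ne', one_mul] at h4
  refine h4.congr' ?_
  filter_upwards [(tendsto_fst_ratioFilter hp).eventually (eventually_ge_atTop 1),
    (tendsto_snd_ratioFilter (p := p)).eventually (eventually_ge_atTop 1)] with x hx1 hx2
  have e1 : (0 : ℝ) < x.1 := by exact_mod_cast hx1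
  have e2 : (0 : ℝ) < x.2 := by exact_mod_cast hx2
  have e3 : (0 : ℝ) < (x.1 : ℝ) ^ t := by positivity
  have e4 : (0 : ℝ) < (x.2 : ℝ) ^ t := by positivity
  have e5 := hβ.pos x.2
  simp only [Pi.div_apply, Function.comp_apply]
  rw [Real.div_rpow e1.le e2.le]
  field_simp

theorem tendsto_succ_div (hβ : IsPowerWeight β t ℓ) :
    Tendsto (fun n : ℕ => β (n + 1) / β n) atTop (𝓝 1) := by
  have h1 := (tendsto_add_atTop_iff_nat 1).2 hβ.tendsto
  have h2 := h1.div hβ.tendsto_succ hβ.limit_pos.ne'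
  rw [div_self hβ.limit_pos.ne'] at h2
  refine h2.congr fun n => ?_
  have e3 : (0 : ℝ) < ((n : ℝ) + 1) ^ t := by positivity
  have := hβ.pos n
  simp only [Pi.div_apply]
  push_cast
  field_simp

theorem exists_succ_div_le (hβ : IsPowerWeight β t ℓ) :
    ∃ D > 0, ∀ n : ℕ, β (n + 1) / β n ≤ D := by
  obtain ⟨D, hD⟩ := hβ.tendsto_succ_div.bddAbove_range
  have h : ∀ n, β (n + 1) / β n ≤ D := fun n => hD ⟨n, rfl⟩
  exact ⟨D, (div_pos (hβ.pos 1) (hβ.pos 0)).trans_le (h 0), h⟩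

end IsPowerWeight

/-! ### Compactness from the binomial kernel, and `C_φ*` compared with `C_σ`. -/

namespace WeightedHardy

variable {β : ℕ → ℝ} {t ℓ : ℝ}

/-- Column `m` sums to at most a constant times `(p+q)^(m+k)`, which tends to zero. -/
theorem isCompactOperator_of_kernel_lt {p q : ℝ} (hp : 0 < p) (hq : 0 ≤ q) (hpq : p + q < 1)
    {L : WeightedHardy β →L[ℂ] WeightedHardy β} {D : ℝ} {k : ℕ} (hD : 0 ≤ D)
    (hL : ∀ n m, ‖entry L n m‖ ≤ D * (binomialKernel p q n m * indexRatio n m ^ k)) :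
    IsCompactOperator L := by
  refine isCompactOperator_of_schur L (tsum_row_le_of_kernel hp hq hpq.le hD hL) ?_
  refine tendsto_of_tendsto_of_tendsto_of_le_of_le tendsto_const_nhds ?_ (fun m => zero_le)
    (tsum_col_le_of_kernel hp hq hD hL)
  have h1 := (tendsto_add_atTop_iff_nat k).2
    (tendsto_pow_atTop_nhds_zero_of_lt_one (r := p + q) (by positivity) hpq)
  have h2 := ENNReal.Tendsto.const_mul (a := ENNReal.ofReal (D * (k.factorial / p ^ k)))
    (ENNReal.tendsto_ofReal h1) (Or.inr ENNReal.ofReal_ne_top)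
  simpa using h2

/-- The polynomial bound on `h` controls the rows. The columns vanish in the limit because their
mass sits at `n ≈ pm`, where `h` is small. -/
theorem isCompactOperator_of_kernel_tendsto {p q : ℝ} (hp : 0 < p) (hq : 0 ≤ q) (hpq : p + q = 1)
    {L : WeightedHardy β →L[ℂ] WeightedHardy β} {h : ℕ × ℕ → ℝ} {D : ℝ} {k : ℕ} (hD : 0 ≤ D)
    (hL : ∀ n m, ‖entry L n m‖ ≤ binomialKernel p q n m * h (n, m))
    (hh : ∀ n m, n ≤ m → h (n, m) ≤ D * indexRatio n m ^ k)
    (hlim : Tendsto h (ratioFilter p) (𝓝 0)) :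
    IsCompactOperator L := by
  refine isCompactOperator_of_schur L (tsum_row_le_of_kernel hp hq hpq.le hD (k := k)
    fun n m => (hL n m).trans ?_) ?_
  · rw [mul_left_comm]
    exact binomialKernel_mul_le hp.le hq (hh n m)
  · refine tendsto_of_tendsto_of_tendsto_of_le_of_le tendsto_const_nhds
      (tendsto_tsum_binomialKernel_mul hp hq hpq hh hlim) (fun m => zero_le) fun m => ?_
    refine ENNReal.tsum_le_tsum fun n => ?_
    rw [← ofReal_norm]
    exact ENNReal.ofReal_le_ofReal (hL n m)

/-- The algebraic source of the adjoint formula: up to weights, the matrices of `C_φ*` and `C_σ`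
differ only by the factor `n/m`. -/
theorem star_fractionalCoeff (P Q : ℂ) (n m : ℕ) :
    star (fractionalCoeff P Q m n)
      = (if m = 0 then 1 else (n : ℂ) / m) * affineCoeff (star P) (star Q) n m := by
  rw [fractionalCoeff, affineCoeff]
  split_ifs <;> simp

theorem norm_entry_affine (hβ : IsPowerWeight β t ℓ) {P Q : ℂ}
    {L : WeightedHardy β →L[ℂ] WeightedHardy β}
    (hL : ∀ n m, entry L n m = affineCoeff P Q n m * (β n / β m)) (n m : ℕ) :
    ‖entry L n m‖ = binomialKernel ‖P‖ ‖Q‖ n m * (β n / β m) := by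
  rw [hL, norm_mul, norm_affineCoeff, norm_ofReal_div hβ]

theorem isCompactOperator_affine (hβ : IsPowerWeight β t ℓ) {P Q : ℂ} (hP : P ≠ 0)
    (hPQ : ‖P‖ + ‖Q‖ < 1) {L : WeightedHardy β →L[ℂ] WeightedHardy β}
    (hL : ∀ n m, entry L n m = affineCoeff P Q n m * (β n / β m)) : IsCompactOperator L := by
  obtain ⟨C, hC, k, h⟩ := hβ.exists_ratio_le
  refine isCompactOperator_of_kernel_lt (norm_pos_iff.2 hP) (norm_nonneg Q) hPQ (D := C) (k := k)
    hC.le fun n m => ?_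
  rw [norm_entry_affine hβ hL, mul_left_comm C]
  exact binomialKernel_mul_le (norm_nonneg _) (norm_nonneg _) fun hnm => (h n m hnm).1

theorem isCompactOperator_adjoint_fractional (hβ : IsPowerWeight β t ℓ) {P Q : ℂ} (hP : P ≠ 0)
    (hPQ : ‖P‖ + ‖Q‖ < 1) {L : WeightedHardy β →L[ℂ] WeightedHardy β}
    (hL : ∀ n m, entry L n m = fractionalCoeff P Q n m * (β n / β m)) :
    IsCompactOperator (ContinuousLinearMap.adjoint L) := by
  obtain ⟨C, hC, k, h⟩ := hβ.exists_ratio_le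
  refine isCompactOperator_of_kernel_lt (norm_pos_iff.2 hP) (norm_nonneg Q) hPQ (D := C) (k := k)
    hC.le fun n m => ?_
  rw [entry_adjoint, norm_star, hL, norm_mul, norm_ofReal_div hβ, mul_left_comm C]
  refine (mul_le_mul_of_nonneg_right (norm_fractionalCoeff_le P Q m n)
    (div_pos (hβ.pos m) (hβ.pos n)).le).trans ?_
  exact binomialKernel_mul_le (norm_nonneg _) (norm_nonneg _) fun hnm => (h n m hnm).2

/-- At a point of tangency, the adjoint of the composition operator with
`Pz / (1 - Qz)` is a multiple of the composition operator with `P̄z + Q̄` modulo compacts. -/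
theorem isCompactOperator_adjoint_fractional_sub (hβ : IsPowerWeight β t ℓ) {P Q : ℂ} (hP : P ≠ 0)
    (hPQ : ‖P‖ + ‖Q‖ = 1) {L K : WeightedHardy β →L[ℂ] WeightedHardy β}
    (hL : ∀ n m, entry L n m = fractionalCoeff P Q n m * (β n / β m))
    (hK : ∀ n m, entry K n m = affineCoeff (star P) (star Q) n m * (β n / β m)) :
    IsCompactOperator
      (ContinuousLinearMap.adjoint L - ((‖P‖ ^ (1 - 2 * t) : ℝ) : ℂ) • K) := by
  obtain ⟨C, hC, k, h⟩ := hβ.exists_ratio_le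
  have hp := norm_pos_iff.2 hP
  set lam : ℝ := ‖P‖ ^ (1 - 2 * t) with hlam
  have hlam0 : 0 < lam := by positivity
  -- The value `1` at `m = 0` matches the convention in `fractionalCoeff`.
  let r : ℕ × ℕ → ℝ := fun x => if x.2 = 0 then 1 else (x.1 : ℝ) / x.2
  refine isCompactOperator_of_kernel_tendsto hp (norm_nonneg Q) hPQ (D := C + lam * C) (k := k)
    (h := fun x => |r x * (β x.2 / β x.1) - lam * (β x.1 / β x.2)|) (by positivity) ?_ ?_ ?_
  · intro n m
    rw [entry_sub, entry_smul, entry_adjoint, hL, hK, star_mul', star_fractionalCoeff]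
    have e : (if m = 0 then 1 else (n : ℂ) / m) * affineCoeff (star P) (star Q) n m *
          star ((β m / β n : ℂ)) - lam * (affineCoeff (star P) (star Q) n m * (β n / β m))
        = affineCoeff (star P) (star Q) n m *
          ((r (n, m) * (β m / β n) - lam * (β n / β m) : ℝ) : ℂ) := by
      have : star ((β m / β n : ℂ)) = β m / β n := by simp
      rw [this]
      simp only [r]
      split_ifs <;> push_cast <;> ring
    rw [e, norm_mul, norm_affineCoeff, Complex.norm_real, norm_star, norm_star, Real.norm_eq_abs]
  · intro n m hnm
    have h1 := h n m hnm
    have hr : 0 ≤ r (n, m) ∧ r (n, m) ≤ 1 := by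
      simp only [r]
      split_ifs with h0
      · exact ⟨zero_le_one, le_rfl⟩
      · have : (0 : ℝ) < m := by positivity
        refine ⟨by positivity, ?_⟩
        rw [div_le_one this]
        exact_mod_cast hnm
    have hx := div_pos (hβ.pos m) (hβ.pos n)
    have hy := div_pos (hβ.pos n) (hβ.pos m)
    refine (abs_sub _ _).trans ?_
    rw [abs_of_nonneg (mul_nonneg hr.1 hx.le), abs_of_nonneg (by positivity), add_mul, mul_assoc]
    refine add_le_add ?_ ?_
    · exact (mul_le_of_le_one_left hx.le hr.2).trans h1.2
    · exact mul_le_mul_of_nonneg_left h1.1 hlam0.le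
  · have h1 := hβ.tendsto_ratio hp
    have h2 := h1.inv₀ (by positivity)
    have h3 : Tendsto r (ratioFilter ‖P‖) (𝓝 ‖P‖) := by
      refine (tendsto_ratioFilter (p := ‖P‖)).congr' ?_
      filter_upwards [(tendsto_snd_ratioFilter (p := ‖P‖)).eventually (eventually_ge_atTop 1)]
        with x hx
      have : x.2 ≠ 0 := by
        have : 1 ≤ x.2 := hx
        omega
      simp only [r, if_neg this]
    have h4 := ((h3.mul h2).sub (h1.const_mul lam)).abs
    -- This cancellation dictates the exponent `1 - 2t` in `lam`.
    have e : ‖P‖ * (‖P‖ ^ t)⁻¹ - lam * ‖P‖ ^ t = 0 := by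
      rw [hlam, ← Real.rpow_neg hp.le, ← Real.rpow_add hp]
      nth_rewrite 1 [← Real.rpow_one ‖P‖]
      rw [← Real.rpow_add hp, sub_eq_zero]
      congr 1
      ring
    rw [e, abs_zero] at h4
    refine h4.congr fun x => ?_
    rw [inv_div]

/-! ### The backward shift on the range of `C_σ`. -/

theorem toLp_adjoint_shift {S : WeightedHardy β →L[ℂ] WeightedHardy β}
    (hS : ∀ n m, entry S n m = (if n = m + 1 then 1 else 0) * (β n / β m))
    (f : WeightedHardy β) (n : ℕ) :
    (ContinuousLinearMap.adjoint S f).toLp n = (β (n + 1) / β n) * f.toLp (n + 1) := by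
  have h : S (unit β n) = (β (n + 1) / β n : ℂ) • unit β (n + 1) := ext_toLp fun j => by
    have := hS j n
    rw [entry] at this
    rw [this, toLp_smul, toLp_unit]
    split_ifs with hj
    · rw [hj]; ring
    · ring
  rw [← inner_unit_left, ContinuousLinearMap.adjoint_inner_right, h, inner_smul_left,
    inner_unit_left]
  simp

/-- Consecutive entries of a column have ratio `(m-n)/(n+1) · P/Q`. Along `n ≈ pm` with `p + q = 1`
this tends to `(q/p)(P/Q)`, which is unimodular. The form without division needs no assumption on
`Q` or on `n < m`. -/
theorem affineCoeff_succ (P Q : ℂ) (n m : ℕ) :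
    affineCoeff P Q (n + 1) m * ((n + 1) * Q) = affineCoeff P Q n m * ((m - n) * P) := by
  rcases lt_or_ge n m with h | h
  · have h1 : ((m.choose (n + 1) : ℂ)) * (n + 1) = m.choose n * (m - n) := by
      have := Nat.choose_succ_right_eq m n
      rw [← Nat.cast_sub h.le]
      exact_mod_cast this
    have h2 : Q ^ (m - n) = Q ^ (m - (n + 1)) * Q := by
      rw [← pow_succ]; congr 1; omega
    rw [affineCoeff, affineCoeff, h2, pow_succ]
    linear_combination P ^ n * P * Q ^ (m - (n + 1)) * Q * h1
  · rw [affineCoeff, Nat.choose_eq_zero_of_lt (by omega)]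
    rcases h.lt_or_eq with h | h
    · rw [affineCoeff, Nat.choose_eq_zero_of_lt h]; simp
    · rw [h]; simp

/-- At a point of tangency, the backward shift acts on the range of the composition operator
with `Pz + Q` as multiplication by a unimodular constant, modulo compacts. -/
theorem isCompactOperator_adjoint_shift_comp_sub (hβ : IsPowerWeight β t ℓ) {P Q ω : ℂ}
    (hP : P ≠ 0) (hQ : Q ≠ 0) (hPQ : ‖P‖ + ‖Q‖ = 1) (hω : ‖ω‖ = 1) (hωPQ : P * ‖Q‖ = ω * Q * ‖P‖)
    {S K : WeightedHardy β →L[ℂ] WeightedHardy β}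
    (hS : ∀ n m, entry S n m = (if n = m + 1 then 1 else 0) * (β n / β m))
    (hK : ∀ n m, entry K n m = affineCoeff P Q n m * (β n / β m)) :
    IsCompactOperator (ContinuousLinearMap.adjoint S ∘L K - ω • K) := by
  obtain ⟨C, hC, k, h⟩ := hβ.exists_ratio_le
  obtain ⟨D, hD, hD'⟩ := hβ.exists_succ_div_le
  have hp := norm_pos_iff.2 hP
  have hq := norm_pos_iff.2 hQ
  -- The entry of `S*K` divided by that of `ωK`. The weight ratio is squared since it occurs once in
  -- `S*` and once in passing from row `n` to row `n+1` of `K`.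
  let r : ℕ × ℕ → ℝ := fun x =>
    (β (x.1 + 1) / β x.1) ^ 2 * (((x.2 : ℝ) - x.1) / (x.1 + 1)) * (‖P‖ / ‖Q‖)
  refine isCompactOperator_of_kernel_tendsto hp hq.le hPQ
    -- The exponent is `k + 1` because `(m-n)/(n+1)` costs one more power of the index ratio.
    (D := C * (D ^ 2 * (‖P‖ / ‖Q‖) + 1)) (k := k + 1)
    (h := fun x => β x.1 / β x.2 * |r x - 1|) (by positivity) ?_ ?_ ?_
  · intro n m
    have h1 : entry (ContinuousLinearMap.adjoint S ∘L K) n m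
        = (β (n + 1) / β n) * (affineCoeff P Q (n + 1) m * (β (n + 1) / β m)) := by
      rw [← hK]
      exact toLp_adjoint_shift hS _ n
    have hn1 : ((n : ℂ) + 1) ≠ 0 := by exact_mod_cast n.succ_ne_zero
    have hq' : (‖Q‖ : ℂ) ≠ 0 := by exact_mod_cast hq.ne'
    have h2 : affineCoeff P Q (n + 1) m
        = affineCoeff P Q n m * (((m : ℂ) - n) / (n + 1)) * (ω * (‖P‖ / ‖Q‖)) := by
      have h3 := affineCoeff_succ P Q n m
      have h4 : P = ω * (‖P‖ / ‖Q‖) * Q := by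
        field_simp
        linear_combination hωPQ
      have h5 : affineCoeff P Q (n + 1) m * ((n + 1) * Q)
          = affineCoeff P Q n m * ((m - n) * (ω * (‖P‖ / ‖Q‖) * Q)) := by
        rw [h3, ← h4]
      refine mul_right_cancel₀ (mul_ne_zero hn1 hQ) (h5.trans ?_)
      field_simp
    have hbn : (β n : ℂ) ≠ 0 := by exact_mod_cast (hβ.pos n).ne'
    have hbm : (β m : ℂ) ≠ 0 := by exact_mod_cast (hβ.pos m).ne'
    have e : entry (ContinuousLinearMap.adjoint S ∘L K - ω • K) n m
        = affineCoeff P Q n m * ω * (((β n / β m) * (r (n, m) - 1) : ℝ) : ℂ) := by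
      rw [entry_sub, entry_smul, h1, h2, hK]
      simp only [r]
      push_cast
      field_simp
    rw [e, norm_mul, norm_mul, hω, mul_one, norm_affineCoeff, Complex.norm_real, Real.norm_eq_abs,
      abs_mul, abs_of_pos (div_pos (hβ.pos n) (hβ.pos m))]
  · intro n m hnm
    have h1 := (h n m hnm).1
    have hρ := one_le_indexRatio hnm
    have hx := div_pos (hβ.pos (n + 1)) (hβ.pos n)
    have hy := div_pos (hβ.pos n) (hβ.pos m)
    have hnm' : (0 : ℝ) ≤ m - n := sub_nonneg.2 (by exact_mod_cast hnm)
    have hr0 : 0 ≤ r (n, m) := by simp only [r]; positivity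
    have hr : r (n, m) ≤ D ^ 2 * indexRatio n m * (‖P‖ / ‖Q‖) := by
      simp only [r, indexRatio]
      gcongr
      · exact hD' n
      · linarith [(n.cast_nonneg : (0 : ℝ) ≤ n)]
    have h2 : |r (n, m) - 1| ≤ (D ^ 2 * (‖P‖ / ‖Q‖) + 1) * indexRatio n m := by
      refine (abs_sub _ _).trans ?_
      rw [abs_of_nonneg hr0, abs_one]
      nlinarith
    calc β n / β m * |r (n, m) - 1|
        ≤ C * indexRatio n m ^ k * ((D ^ 2 * (‖P‖ / ‖Q‖) + 1) * indexRatio n m) :=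
          mul_le_mul h1 h2 (abs_nonneg _) (hy.le.trans h1)
      _ = _ := by ring
  · have h1 := hβ.tendsto_ratio hp
    have h2 := (hβ.tendsto_succ_div.comp (tendsto_fst_ratioFilter hp)).pow 2
    have h0 : Tendsto (fun x : ℕ × ℕ => 1 / (x.2 : ℝ)) (ratioFilter ‖P‖) (𝓝 0) :=
      (tendsto_one_div_atTop_nhds_zero_nat (𝕜 := ℝ)).comp tendsto_snd_ratioFilter
    have hr := tendsto_ratioFilter (p := ‖P‖)
    have h3 := ((tendsto_const_nhds (x := (1 : ℝ))).sub hr).div (hr.add h0) (by simpa using hp.ne')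
    have h4 : Tendsto r (ratioFilter ‖P‖) (𝓝 1) := by
      have h5 := (h2.mul h3).mul_const (‖P‖ / ‖Q‖)
      have e : (1 : ℝ) ^ 2 * ((1 - ‖P‖) / (‖P‖ + 0)) * (‖P‖ / ‖Q‖) = 1 := by
        have : 1 - ‖P‖ = ‖Q‖ := by linarith
        rw [this]
        field_simp
        simp
      rw [e] at h5
      refine h5.congr' ?_
      filter_upwards [(tendsto_snd_ratioFilter (p := ‖P‖)).eventually (eventually_ge_atTop 1)]
        with x hx
      have e2 : (0 : ℝ) < x.2 := by exact_mod_cast hx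
      have e3 : ((1 : ℝ) - x.1 / x.2) / (x.1 / x.2 + 1 / x.2) = (x.2 - x.1) / (x.1 + 1) := by
        field_simp
      simp only [r, Pi.div_apply, Function.comp_apply]
      rw [e3]
    have h5 := h1.mul (h4.sub_const 1).abs
    simpa using h5

/-- Telescoping: `S*ʲ⁺¹K - ωʲ⁺¹K = S*(S*ʲK - ωʲK) + ωʲ(S*K - ωK)`. -/
theorem isCompactOperator_adjoint_pow_comp_sub {S K : WeightedHardy β →L[ℂ] WeightedHardy β}
    {ω : ℂ} (h : IsCompactOperator (ContinuousLinearMap.adjoint S ∘L K - ω • K)) (j : ℕ) :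
    IsCompactOperator (ContinuousLinearMap.adjoint (S ^ j) ∘L K - ω ^ j • K) := by
  induction j with
  | zero =>
    have e : ContinuousLinearMap.adjoint (S ^ 0) ∘L K - ω ^ 0 • K = 0 := by
      rw [pow_zero, pow_zero, one_smul, ← ContinuousLinearMap.star_eq_adjoint, star_one]
      ext f
      simp
    rw [e]
    exact isCompactOperator_zero
  | succ j ih =>
    have e : ContinuousLinearMap.adjoint (S ^ (j + 1)) ∘L K - ω ^ (j + 1) • K
        = ContinuousLinearMap.adjoint S ∘L (ContinuousLinearMap.adjoint (S ^ j) ∘L K - ω ^ j • K)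
          + ω ^ j • (ContinuousLinearMap.adjoint S ∘L K - ω • K) := by
      have h1 : ContinuousLinearMap.adjoint (S ^ (j + 1))
          = ContinuousLinearMap.adjoint S ∘L ContinuousLinearMap.adjoint (S ^ j) := by
        rw [← ContinuousLinearMap.adjoint_comp, pow_succ]
        rfl
      rw [h1]
      ext f
      simp only [sub_apply, add_apply, smul_apply, ContinuousLinearMap.comp_apply, map_sub,
        map_smul, smul_sub, smul_smul, pow_succ]
      abel
    rw [e]
    exact (ih.clm_comp (ContinuousLinearMap.adjoint S)).add (h.smul (ω ^ j))

/-- Compact operators are norm closed, so the relation for powers passes to norm-convergent series.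
The scalar `γ` is the value of the series at `ω̄`, conjugated by the adjoint. -/
theorem isCompactOperator_adjoint_series_comp_sub {S K M : WeightedHardy β →L[ℂ] WeightedHardy β}
    {ω γ : ℂ} (h : IsCompactOperator (ContinuousLinearMap.adjoint S ∘L K - ω • K)) {g : ℕ → ℂ}
    (hM : HasSum (fun j => g j • S ^ j) M) (hγ : HasSum (fun j => g j * star ω ^ j) γ) :
    IsCompactOperator (ContinuousLinearMap.adjoint M ∘L K - star γ • K) := by
  let F : ℕ → WeightedHardy β →L[ℂ] WeightedHardy β := fun N =>
    ContinuousLinearMap.adjoint (∑ j ∈ Finset.range N, g j • S ^ j) ∘L K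
      - star (∑ j ∈ Finset.range N, g j * star ω ^ j) • K
  have hF : Tendsto F atTop (𝓝 (ContinuousLinearMap.adjoint M ∘L K - star γ • K)) := by
    refine Tendsto.sub ?_ ?_
    · have h1 : Tendsto (fun N => ContinuousLinearMap.adjoint (∑ j ∈ Finset.range N, g j • S ^ j))
          atTop (𝓝 (ContinuousLinearMap.adjoint M)) :=
        (ContinuousLinearMap.adjoint.continuous.tendsto M).comp hM.tendsto_sum_nat
      exact (((ContinuousLinearMap.compL ℂ _ _ _).flip K).continuous.tendsto _).comp h1
    · exact (((continuous_star.tendsto γ).comp hγ.tendsto_sum_nat)).smul_const K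
  refine isCompactOperator_of_tendsto hF (Eventually.of_forall fun N => ?_)
  have e : F N = ∑ j ∈ Finset.range N,
      star (g j) • (ContinuousLinearMap.adjoint (S ^ j) ∘L K - ω ^ j • K) := by
    simp only [F]
    induction N with
    | zero =>
      ext f
      simp
    | succ N ih =>
      rw [Finset.sum_range_succ, Finset.sum_range_succ, Finset.sum_range_succ, ← ih, map_add,
        star_add]
      ext f
      simp only [sub_apply, add_apply, smul_apply, ContinuousLinearMap.comp_apply, smul_sub,
        smul_smul, add_smul, map_smulₛₗ, star_mul', star_pow, star_star, starRingEnd_apply]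
      abel
  rw [e]
  exact Submodule.sum_mem (p := compactOperator (RingHom.id ℂ) (WeightedHardy β) (WeightedHardy β))
    (f := fun j => star (g j) • (ContinuousLinearMap.adjoint (S ^ j) ∘L K - ω ^ j • K))
    fun j _ => (isCompactOperator_adjoint_pow_comp_sub h j).smul (star (g j))

/-! ### Multiplication operators and powers of the shift. -/

theorem IsMultiplicationOperator.one :
    IsMultiplicationOperator (fun _ => 1) (1 : WeightedHardy β →L[ℂ] WeightedHardy β) :=
  fun _ _ _ => (one_mul _).symm

theorem IsMultiplicationOperator.mul {G H : ℂ → ℂ} {M N : WeightedHardy β →L[ℂ] WeightedHardy β}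
    (hM : IsMultiplicationOperator G M) (hN : IsMultiplicationOperator H N) :
    IsMultiplicationOperator (fun z => G z * H z) (M * N) := fun f z hz => by
  rw [mul_apply_eq_comp, hM _ z hz, hN _ z hz, mul_assoc]

theorem IsMultiplicationOperator.pow {G : ℂ → ℂ} {M : WeightedHardy β →L[ℂ] WeightedHardy β}
    (hM : IsMultiplicationOperator G M) (j : ℕ) :
    IsMultiplicationOperator (fun z => G z ^ j) (M ^ j) := by
  induction j with
  | zero => simpa using IsMultiplicationOperator.one
  | succ j ih => simpa only [pow_succ] using ih.mul hM

theorem IsMultiplicationOperator.congr {G H : ℂ → ℂ}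
    {M : WeightedHardy β →L[ℂ] WeightedHardy β} (hM : IsMultiplicationOperator G M)
    (h : ∀ z ∈ ball (0 : ℂ) 1, G z = H z) : IsMultiplicationOperator H M := fun f z hz => by
  rw [hM f z hz, h z hz]

theorem IsMultiplicationOperator.one_add_smul (hβ : IsPowerWeight β t ℓ) {G : ℂ → ℂ} (r : ℂ)
    {M : WeightedHardy β →L[ℂ] WeightedHardy β} (hM : IsMultiplicationOperator G M) :
    IsMultiplicationOperator (fun z => r * G z + 1) (r • M + 1) := fun f z hz => by
  obtain ⟨ev, hev⟩ := exists_eval_clm hβ hz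
  rw [← hev, ← hev, add_apply, smul_apply, one_apply_eq_self, map_add, map_smul,
    hev, hev, hM f z hz, smul_eq_mul]
  ring

/-- This lets an arbitrary bounded `M_G` be identified with one built as a series in the shift. -/
theorem IsMultiplicationOperator.unique (hβ : IsPowerWeight β t ℓ) {G : ℂ → ℂ}
    {M N : WeightedHardy β →L[ℂ] WeightedHardy β} (hM : IsMultiplicationOperator G M)
    (hN : IsMultiplicationOperator G N) : M = N := by
  ext f
  exact ext_eval hβ.pos hβ.limit_pos hβ.tendsto _ _ fun z hz => by rw [hM f z hz, hN f z hz]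

/-- A norm-convergent power series in the shift is a multiplication operator. -/
theorem isMultiplicationOperator_of_hasSum (hβ : IsPowerWeight β t ℓ)
    {S M : WeightedHardy β →L[ℂ] WeightedHardy β} (hS : IsMultiplicationOperator (fun z => z) S)
    {g : ℕ → ℂ} {G : ℂ → ℂ} (hM : HasSum (fun j => g j • S ^ j) M)
    (hG : ∀ z ∈ ball (0 : ℂ) 1, HasSum (fun j => g j * z ^ j) (G z)) :
    IsMultiplicationOperator G M := fun f z hz => by
  obtain ⟨ev, hev⟩ := exists_eval_clm hβ hz
  have h1 := (ev.comp (ContinuousLinearMap.apply ℂ (WeightedHardy β) f)).hasSum hM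
  have h2 := (hG z hz).mul_right (f.eval z)
  rw [← hev (M f)]
  refine HasSum.unique (f := fun j => g j * z ^ j * f.eval z) ?_ h2
  refine h1.congr_fun fun j => ?_
  simp only [ContinuousLinearMap.comp_apply, ContinuousLinearMap.apply_apply,
    map_smul, hev, smul_eq_mul]
  rw [hS.pow j f z hz, mul_assoc]

theorem shift_pow_unit (hβ : IsPowerWeight β t ℓ) {S : WeightedHardy β →L[ℂ] WeightedHardy β}
    (hS : ∀ n m, entry S n m = (if n = m + 1 then 1 else 0) * (β n / β m)) (j m : ℕ) :
    (S ^ j) (unit β m) = (β (m + j) / β m : ℂ) • unit β (m + j) := by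
  have hne : ∀ n, (β n : ℂ) ≠ 0 := fun n => by exact_mod_cast (hβ.pos n).ne'
  induction j with
  | zero => simp [div_self (hne m)]
  | succ j ih =>
    have h : S (unit β (m + j)) = (β (m + j + 1) / β (m + j) : ℂ) • unit β (m + j + 1) :=
      ext_toLp fun n => by
        have := hS n (m + j)
        rw [entry] at this
        rw [this, toLp_smul, toLp_unit]
        split_ifs with hj
        · rw [hj]; ring
        · ring
    rw [pow_succ', mul_apply_eq_comp, ih, map_smul, h, smul_smul, ← add_assoc]
    congr 1
    have := hne (m + j)
    field_simp

theorem entry_shift_pow (hβ : IsPowerWeight β t ℓ) {S : WeightedHardy β →L[ℂ] WeightedHardy β}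
    (hS : ∀ n m, entry S n m = (if n = m + 1 then 1 else 0) * (β n / β m)) (j n m : ℕ) :
    entry (S ^ j) n m = (if n = m + j then 1 else 0) * (β n / β m) := by
  rw [entry, shift_pow_unit hβ hS, toLp_smul, toLp_unit]
  split_ifs with h
  · rw [h]; ring
  · ring

theorem toLp_shift_pow (hβ : IsPowerWeight β t ℓ) {S : WeightedHardy β →L[ℂ] WeightedHardy β}
    (hS : ∀ n m, entry S n m = (if n = m + 1 then 1 else 0) * (β n / β m)) (j n : ℕ)
    (f : WeightedHardy β) :
    ((S ^ j) f).toLp n = if j ≤ n then (β n / β (n - j)) * f.toLp (n - j) else 0 := by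
  rw [← (hasSum_entry (S ^ j) f n).tsum_eq]
  simp only [entry_shift_pow hβ hS]
  split_ifs with h
  · rw [tsum_eq_single (n - j) fun m hm => by rw [if_neg (by omega)]; ring, if_pos (by omega),
      one_mul]
  · refine (tsum_congr fun m => ?_).trans tsum_zero
    rw [if_neg (by omega)]
    ring

/-- `S ^ j` is a weighted shift with weights `β(m+j)/β(m)`, and `(m+j+1)/(m+1) ≤ j+1`. Growth is
therefore polynomial, and geometrically decaying coefficients give norm convergence. -/
theorem exists_norm_shift_pow_le (hβ : IsPowerWeight β t ℓ)
    {S : WeightedHardy β →L[ℂ] WeightedHardy β}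
    (hS : ∀ n m, entry S n m = (if n = m + 1 then 1 else 0) * (β n / β m)) :
    ∃ C > 0, ∃ k : ℕ, ∀ j : ℕ, ‖S ^ j‖ ≤ C * ((j : ℝ) + 1) ^ k := by
  obtain ⟨C, hC, k, h⟩ := hβ.exists_ratio_le
  refine ⟨C, hC, k, fun j => ?_⟩
  have hb : ∀ m : ℕ, ‖(β (m + j) / β m : ℂ)‖ₑ ≤ ((C * ((j : ℝ) + 1) ^ k).toNNReal : ℝ≥0) := fun m => by
    rw [← ofReal_norm]
    refine ENNReal.ofReal_le_ofReal ?_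
    rw [norm_ofReal_div hβ]
    refine (h m (m + j) (by omega)).2.trans ?_
    have : indexRatio m (m + j) ≤ j + 1 := by
      rw [indexRatio, div_le_iff₀ (by positivity)]
      push_cast
      nlinarith [(m.cast_nonneg : (0 : ℝ) ≤ m), (j.cast_nonneg : (0 : ℝ) ≤ j),
        mul_nonneg (m.cast_nonneg : (0 : ℝ) ≤ m) (j.cast_nonneg : (0 : ℝ) ≤ j)]
    have := indexRatio_pos m (m + j)
    gcongr
  refine (norm_le_of_schur (S ^ j) (A := (C * ((j : ℝ) + 1) ^ k).toNNReal)
    (B := (C * ((j : ℝ) + 1) ^ k).toNNReal) (fun n => ?_) fun m => ?_).trans_eq ?_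
  · simp only [entry_shift_pow hβ hS]
    rcases lt_or_ge n j with hn | hn
    · refine (le_of_eq ?_).trans zero_le
      refine (tsum_congr fun m => ?_).trans tsum_zero
      rw [if_neg (by omega), zero_mul, enorm_zero]
    · rw [tsum_eq_single (n - j) fun m hm => by rw [if_neg (by omega), zero_mul, enorm_zero],
        if_pos (by omega), one_mul]
      have := hb (n - j)
      rwa [Nat.sub_add_cancel hn] at this
  · simp only [entry_shift_pow hβ hS]
    rw [tsum_eq_single (m + j) fun n hn => by rw [if_neg hn, zero_mul, enorm_zero],
        if_pos rfl, one_mul]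
    exact hb m
  · rw [Real.coe_toNNReal _ (by positivity), Real.sqrt_mul_self (by positivity)]

theorem summable_shift_of_geometric (hβ : IsPowerWeight β t ℓ)
    {S : WeightedHardy β →L[ℂ] WeightedHardy β}
    (hS : ∀ n m, entry S n m = (if n = m + 1 then 1 else 0) * (β n / β m)) {g : ℕ → ℂ} {D r : ℝ}
    (hr0 : 0 ≤ r) (hr : r < 1) (hg : ∀ j, ‖g j‖ ≤ D * r ^ j) :
    Summable fun j => g j • S ^ j := by
  obtain ⟨C, hC, k, h⟩ := exists_norm_shift_pow_le hβ hS
  have hs := summable_pow_mul_geometric_of_norm_lt_one (R := ℝ) k (r := r)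
    (by rwa [Real.norm_of_nonneg hr0])
  have hD : 0 ≤ D := by simpa using (norm_nonneg _).trans (hg 0)
  rcases hr0.eq_or_lt with rfl | hr0
  · refine summable_of_ne_finset_zero (s := {0}) fun j hj => ?_
    have : j ≠ 0 := by simpa using hj
    have h1 := hg j
    rw [zero_pow this, mul_zero] at h1
    rw [norm_le_zero_iff.1 h1, zero_smul]
  have hs' : Summable fun j : ℕ => ((j : ℝ) + 1) ^ k * r ^ j := by
    have h1 := ((summable_nat_add_iff 1).2 hs).mul_right r⁻¹
    refine h1.congr fun j => ?_
    push_cast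
    rw [pow_succ]
    field_simp
  refine Summable.of_norm_bounded (hs'.mul_left (D * C)) fun j => ?_
  rw [norm_smul]
  calc ‖g j‖ * ‖S ^ j‖ ≤ D * r ^ j * (C * ((j : ℝ) + 1) ^ k) := by
        gcongr
        · exact hg j
        · exact h j
    _ = _ := by ring

end WeightedHardy

/-! ### The algebra property for `t > 1/2` and series in the shift. -/

namespace IsPowerWeight

variable {β : ℕ → ℝ} {t ℓ : ℝ}

theorem summable_inv_sq (hβ : IsPowerWeight β t ℓ) (ht : 1 / 2 < t) :
    Summable fun n => 1 / β n ^ 2 := by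
  obtain ⟨c, hc, C, hC, h⟩ := hβ.exists_bounds
  have hs := ((Real.summable_one_div_nat_add_rpow 1 (2 * t)).2 (by linarith)).mul_left (1 / c ^ 2)
  refine Summable.of_nonneg_of_le (fun n => by have := hβ.pos n; positivity) (fun n => ?_) hs
  have hn : (0 : ℝ) < (n : ℝ) + 1 := by positivity
  have hX : (0 : ℝ) < ((n : ℝ) + 1) ^ t := by positivity
  rw [abs_of_pos hn, mul_comm 2 t, Real.rpow_mul hn.le, Real.rpow_two]
  have h1 : (c * ((n : ℝ) + 1) ^ t) ^ 2 ≤ β n ^ 2 := by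
    have := (h n).1
    gcongr
  calc 1 / β n ^ 2 ≤ 1 / (c * ((n : ℝ) + 1) ^ t) ^ 2 := by gcongr
    _ = _ := by field_simp

/-- For `t > 1/2` the weights satisfy the estimate that makes `H²(β)` an algebra. -/
theorem exists_sum_sq_le (hβ : IsPowerWeight β t ℓ) (ht : 1 / 2 < t) :
    ∃ A > 0, ∀ n, ∑ j ∈ Finset.range (n + 1), (β n / (β j * β (n - j))) ^ 2 ≤ A := by
  obtain ⟨c, hc, C, hC, h⟩ := hβ.exists_bounds
  have hs := hβ.summable_inv_sq ht
  have hnn : ∀ n, 0 ≤ 1 / β n ^ 2 := fun n => by have := hβ.pos n; positivity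
  set E : ℝ := C * 2 ^ t / c with hE
  have hE0 : 0 < E := by positivity
  have hT : 0 < ∑' n, 1 / β n ^ 2 :=
    hs.tsum_pos hnn 0 (by have := hβ.pos 0; positivity)
  -- One factor `2` comes from `(x+y)² ≤ 2(x²+y²)`, the other from the two equal sums over `j` and
  -- `n - j`.
  refine ⟨4 * E ^ 2 * ∑' n, 1 / β n ^ 2, by positivity, fun n => ?_⟩
  have hpt : ∀ j ∈ Finset.range (n + 1), (β n / (β j * β (n - j))) ^ 2
      ≤ 2 * E ^ 2 * (1 / β j ^ 2 + 1 / β (n - j) ^ 2) := by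
    intro j hj
    have hjn : j ≤ n := by simpa [Nat.lt_succ_iff] using hj
    have hbj := hβ.pos j
    have hbk := hβ.pos (n - j)
    have hadd : (n : ℝ) = j + (n - j : ℕ) := by rw [Nat.cast_sub hjn]; ring
    -- The larger of `j` and `n - j` is at least `n/2`.
    have h1 : ((n : ℝ) + 1) ^ t ≤ 2 ^ t * (((j : ℝ) + 1) ^ t + (((n - j : ℕ) : ℝ) + 1) ^ t) := by
      rcases le_total j (n - j) with hle | hle
      · have hle' : (j : ℝ) ≤ (n - j : ℕ) := by exact_mod_cast hle
        calc ((n : ℝ) + 1) ^ t ≤ (2 * (((n - j : ℕ) : ℝ) + 1)) ^ t :=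
              Real.rpow_le_rpow (by positivity) (by linarith) (by linarith)
          _ = 2 ^ t * (((n - j : ℕ) : ℝ) + 1) ^ t := Real.mul_rpow (by norm_num) (by positivity)
          _ ≤ _ := by gcongr; exact le_add_of_nonneg_left (by positivity)
      · have hle' : ((n - j : ℕ) : ℝ) ≤ j := by exact_mod_cast hle
        calc ((n : ℝ) + 1) ^ t ≤ (2 * ((j : ℝ) + 1)) ^ t :=
              Real.rpow_le_rpow (by positivity) (by linarith) (by linarith)
          _ = 2 ^ t * ((j : ℝ) + 1) ^ t := Real.mul_rpow (by norm_num) (by positivity)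
          _ ≤ _ := by gcongr; exact le_add_of_nonneg_right (by positivity)
    have h2 : β n ≤ E * (β j + β (n - j)) := by
      calc β n ≤ C * ((n : ℝ) + 1) ^ t := (h n).2
        _ ≤ C * (2 ^ t * (((j : ℝ) + 1) ^ t + (((n - j : ℕ) : ℝ) + 1) ^ t)) := by gcongr
        _ = E * (c * ((j : ℝ) + 1) ^ t + c * (((n - j : ℕ) : ℝ) + 1) ^ t) := by
            rw [hE]; field_simp
        _ ≤ _ := by
            gcongr
            · exact (h j).1
            · exact (h (n - j)).1
    have h3 : β n / (β j * β (n - j)) ≤ E * (1 / β j + 1 / β (n - j)) := by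
      rw [div_le_iff₀ (by positivity)]
      calc β n ≤ E * (β j + β (n - j)) := h2
        _ = _ := by field_simp; ring
    have h4 : 0 ≤ β n / (β j * β (n - j)) := by have := hβ.pos n; positivity
    calc (β n / (β j * β (n - j))) ^ 2 ≤ (E * (1 / β j + 1 / β (n - j))) ^ 2 := by gcongr
      _ = E ^ 2 * (1 / β j + 1 / β (n - j)) ^ 2 := by ring
      _ ≤ E ^ 2 * (2 * ((1 / β j) ^ 2 + (1 / β (n - j)) ^ 2)) := by
          gcongr
          exact add_sq_le
      _ = _ := by rw [one_div_pow, one_div_pow]; ring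
  have h5 : ∀ n, ∑ j ∈ Finset.range n, 1 / β j ^ 2 ≤ ∑' n, 1 / β n ^ 2 := fun n =>
    hs.sum_le_tsum _ fun j _ => hnn j
  refine (Finset.sum_le_sum hpt).trans ?_
  rw [← Finset.mul_sum, Finset.sum_add_distrib, Finset.sum_flip fun j => 1 / β j ^ 2]
  have := h5 (n + 1)
  calc 2 * E ^ 2 * _ ≤ 2 * E ^ 2 * ((∑' n, 1 / β n ^ 2) + ∑' n, 1 / β n ^ 2) := by gcongr
    _ = _ := by ring

end IsPowerWeight

namespace WeightedHardy

variable {β : ℕ → ℝ} {t ℓ : ℝ}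

theorem toLp_sum {ι : Type*} (s : Finset ι) (F : ι → WeightedHardy β) (n : ℕ) :
    (∑ j ∈ s, F j).toLp n = ∑ j ∈ s, (F j).toLp n := map_sum (coord β n) F s

/-- For `t > 1/2`, polynomials in the shift are controlled by the norm of `H²(β)`. -/
theorem exists_norm_sum_shift_sq_le (hβ : IsPowerWeight β t ℓ) (ht : 1 / 2 < t)
    {S : WeightedHardy β →L[ℂ] WeightedHardy β}
    (hS : ∀ n m, entry S n m = (if n = m + 1 then 1 else 0) * (β n / β m)) :
    ∃ A > 0, ∀ (g : ℕ → ℂ) (s : Finset ℕ),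
      ‖∑ j ∈ s, g j • S ^ j‖ ^ 2 ≤ A * ∑ j ∈ s, (‖g j‖ * β j) ^ 2 := by
  obtain ⟨A, hA, h⟩ := hβ.exists_sum_sq_le ht
  refine ⟨A, hA, fun g s => ?_⟩
  have hR : 0 ≤ A * ∑ j ∈ s, (‖g j‖ * β j) ^ 2 := by positivity
  have key : ∀ f : WeightedHardy β, ‖(∑ j ∈ s, g j • S ^ j) f‖ ^ 2
      ≤ A * (∑ j ∈ s, (‖g j‖ * β j) ^ 2) * ‖f‖ ^ 2 := by
    intro f
    have h1 := hasSum_norm_toLp_sq ((∑ j ∈ s, g j • S ^ j) f)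
    have hshift : ∀ j, HasSum (fun n => if j ≤ n then ‖f.toLp (n - j)‖ ^ 2 else 0) (‖f‖ ^ 2) := by
      intro j
      refine (hasSum_nat_add_iff' j).1 ?_
      rw [Finset.sum_eq_zero fun i hi => if_neg (by simpa using hi), sub_zero]
      refine (hasSum_norm_toLp_sq f).congr_fun fun n => ?_
      rw [if_pos (by omega), Nat.add_sub_cancel]
    have h2 : HasSum (fun n => A * ∑ j ∈ s, (‖g j‖ * β j) ^ 2 *
        (if j ≤ n then ‖f.toLp (n - j)‖ ^ 2 else 0))
        (A * (∑ j ∈ s, (‖g j‖ * β j) ^ 2) * ‖f‖ ^ 2) := by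
      rw [mul_assoc, Finset.sum_mul]
      exact (hasSum_sum fun j _ => (hshift j).mul_left _).mul_left A
    refine hasSum_le (fun n => ?_) h1 h2
    have e : ((∑ j ∈ s, g j • S ^ j) f).toLp n
        = ∑ j ∈ s with j ≤ n, g j * ((β n / β (n - j)) * f.toLp (n - j)) := by
      rw [sum_apply, toLp_sum, Finset.sum_filter]
      refine Finset.sum_congr rfl fun j _ => ?_
      rw [smul_apply, toLp_smul, toLp_shift_pow hβ hS]
      split_ifs <;> simp
    have h3 : ‖((∑ j ∈ s, g j • S ^ j) f).toLp n‖
        ≤ ∑ j ∈ s with j ≤ n, (β n / (β j * β (n - j))) * (‖g j‖ * β j * ‖f.toLp (n - j)‖) := by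
      rw [e]
      refine (norm_sum_le _ _).trans_eq (Finset.sum_congr rfl fun j _ => ?_)
      rw [norm_mul, norm_mul, norm_ofReal_div hβ]
      have := hβ.pos j
      have := hβ.pos (n - j)
      field_simp
    -- Cauchy–Schwarz splits off `β(n)/(β(j)β(n-j))`, whose squares sum to at most `A`. Summed over
    -- `n`, each shifted copy of `f` contributes `‖f‖²`.
    calc ‖((∑ j ∈ s, g j • S ^ j) f).toLp n‖ ^ 2
        ≤ (∑ j ∈ s with j ≤ n,
            (β n / (β j * β (n - j))) * (‖g j‖ * β j * ‖f.toLp (n - j)‖)) ^ 2 := by gcongr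
      _ ≤ (∑ j ∈ s with j ≤ n, (β n / (β j * β (n - j))) ^ 2) *
            ∑ j ∈ s with j ≤ n, (‖g j‖ * β j * ‖f.toLp (n - j)‖) ^ 2 :=
          Finset.sum_mul_sq_le_sq_mul_sq _ _ _
      _ ≤ A * ∑ j ∈ s with j ≤ n, (‖g j‖ * β j * ‖f.toLp (n - j)‖) ^ 2 := by
          gcongr
          refine (Finset.sum_le_sum_of_subset_of_nonneg (fun j hj => ?_)
            fun _ _ _ => sq_nonneg _).trans (h n)
          simp only [Finset.mem_filter, Finset.mem_range] at hj ⊢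
          omega
      _ = _ := by
          rw [Finset.sum_filter]
          congr 1
          refine Finset.sum_congr rfl fun j _ => ?_
          split_ifs <;> ring
  have h4 : ‖∑ j ∈ s, g j • S ^ j‖ ≤ √(A * ∑ j ∈ s, (‖g j‖ * β j) ^ 2) := by
    refine ContinuousLinearMap.opNorm_le_bound _ (Real.sqrt_nonneg _) fun f => ?_
    calc ‖(∑ j ∈ s, g j • S ^ j) f‖ = √(‖(∑ j ∈ s, g j • S ^ j) f‖ ^ 2) :=
          (Real.sqrt_sq (norm_nonneg _)).symm
      _ ≤ √(A * (∑ j ∈ s, (‖g j‖ * β j) ^ 2) * ‖f‖ ^ 2) := Real.sqrt_le_sqrt (key f)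
      _ = _ := by rw [Real.sqrt_mul hR, Real.sqrt_sq (norm_nonneg _)]
  calc ‖∑ j ∈ s, g j • S ^ j‖ ^ 2 ≤ √(A * ∑ j ∈ s, (‖g j‖ * β j) ^ 2) ^ 2 := by gcongr
    _ = _ := Real.sq_sqrt hR

theorem summable_shift_of_sq (hβ : IsPowerWeight β t ℓ) (ht : 1 / 2 < t)
    {S : WeightedHardy β →L[ℂ] WeightedHardy β}
    (hS : ∀ n m, entry S n m = (if n = m + 1 then 1 else 0) * (β n / β m)) {g : ℕ → ℂ}
    (hg : Summable fun j => (‖g j‖ * β j) ^ 2) : Summable fun j => g j • S ^ j := by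
  obtain ⟨A, hA, h⟩ := exists_norm_sum_shift_sq_le hβ ht hS
  rw [summable_iff_vanishing_norm] at hg ⊢
  intro ε hε
  obtain ⟨s, hs⟩ := hg (ε ^ 2 / A) (by positivity)
  refine ⟨s, fun u hu => ?_⟩
  have h1 := (le_abs_self _).trans_lt (hs u hu)
  rw [lt_div_iff₀ hA, mul_comm] at h1
  exact lt_of_pow_lt_pow_left₀ 2 hε.le ((h g u).trans_lt h1)

/-- `|g| = (|g|β)(1/β)` is at most the sum of the two squares. Absolute convergence makes boundary
values of the series available. -/
theorem summable_norm_of_sq (hβ : IsPowerWeight β t ℓ) (ht : 1 / 2 < t) {g : ℕ → ℂ}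
    (hg : Summable fun j => (‖g j‖ * β j) ^ 2) : Summable fun j => ‖g j‖ := by
  refine Summable.of_nonneg_of_le (fun j => norm_nonneg _) (fun j => ?_)
    (hg.add (hβ.summable_inv_sq ht))
  have hb := hβ.pos j
  have h1 : ‖g j‖ = ‖g j‖ * β j * (1 / β j) := by field_simp
  rw [← one_div_pow]
  nlinarith [sq_nonneg (‖g j‖ * β j - 1 / β j), sq_nonneg (‖g j‖ * β j), sq_nonneg (1 / β j)]

/-- The function `G` is an absolutely convergent power series on the closed disk, and the
corresponding series in the shift `S` converges in norm to `M`. -/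
def IsShiftSeries (S : WeightedHardy β →L[ℂ] WeightedHardy β) (G : ℂ → ℂ)
    (M : WeightedHardy β →L[ℂ] WeightedHardy β) : Prop :=
  ∃ g : ℕ → ℂ, (Summable fun j => ‖g j‖) ∧
    (∀ z ∈ ball (0 : ℂ) 1, HasSum (fun j => g j * z ^ j) (G z)) ∧ HasSum (fun j => g j • S ^ j) M

theorem IsShiftSeries.isMultiplicationOperator (hβ : IsPowerWeight β t ℓ)
    {S M : WeightedHardy β →L[ℂ] WeightedHardy β} (hS : IsMultiplicationOperator (fun z => z) S)
    {G : ℂ → ℂ} (h : IsShiftSeries S G M) : IsMultiplicationOperator G M := by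
  obtain ⟨g, -, hG, hM⟩ := h
  exact isMultiplicationOperator_of_hasSum hβ hS hM hG

/-- For `t > 1/2` every multiplier is a norm-convergent power series in the shift. -/
theorem isShiftSeries_of_isMultiplicationOperator (hβ : IsPowerWeight β t ℓ) (ht : 1 / 2 < t)
    {S M : WeightedHardy β →L[ℂ] WeightedHardy β} (hS : IsMultiplicationOperator (fun z => z) S)
    (hS' : ∀ n m, entry S n m = (if n = m + 1 then 1 else 0) * (β n / β m)) {G : ℂ → ℂ}
    (hM : IsMultiplicationOperator G M) : IsShiftSeries S G M := by
  have h0 : (β 0 : ℂ) ≠ 0 := by exact_mod_cast (hβ.pos 0).ne'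
  -- `F` is `M` applied to the constant function `1`, which puts `G` itself in `H²(β)`.
  let F : WeightedHardy β := M ((β 0 : ℂ) • unit β 0)
  have hF : ∀ z ∈ ball (0 : ℂ) 1, F.eval z = G z := fun z hz => by
    obtain ⟨ev, hev⟩ := exists_eval_clm hβ hz
    simp only [F]
    rw [hM _ z hz, ← hev, map_smul, hev, eval_unit, pow_zero, smul_eq_mul, mul_one_div_cancel h0,
      mul_one]
  have hsq : Summable fun j => (‖F.coeff j‖ * β j) ^ 2 := by
    simpa only [mul_pow] using (hasSum_norm_sq hβ.pos F).summable
  have hG : ∀ z ∈ ball (0 : ℂ) 1, HasSum (fun j => F.coeff j * z ^ j) (G z) := fun z hz => by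
    rw [← hF z hz]
    exact hasSum_eval hβ.pos hβ.limit_pos hβ.tendsto F hz
  obtain ⟨N, hN⟩ := summable_shift_of_sq hβ ht hS' hsq
  refine ⟨F.coeff, summable_norm_of_sq hβ ht hsq, hG, ?_⟩
  rwa [hM.unique hβ (isMultiplicationOperator_of_hasSum hβ hS hN hG)]

/-- Abel's limit theorem identifies the sum of the series at a boundary point. -/
theorem hasSum_of_tendsto_radial {g : ℕ → ℂ} {G : ℂ → ℂ} {w γ : ℂ}
    (hg : Summable fun j => ‖g j‖) (hw : ‖w‖ = 1)
    (hG : ∀ z ∈ ball (0 : ℂ) 1, HasSum (fun j => g j * z ^ j) (G z))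
    (hγ : Tendsto (fun r : ℝ => G (r * w)) (𝓝[<] 1) (𝓝 γ)) :
    HasSum (fun j => g j * w ^ j) γ := by
  have hs : Summable fun j => g j * w ^ j := by
    refine Summable.of_norm ?_
    simpa [hw] using hg
  have h1 := Complex.tendsto_tsum_powerSeries_nhdsWithin_lt hs.hasSum.tendsto_sum_nat
  rw [tendsto_map'_iff] at h1
  have h2 : Tendsto (fun r : ℝ => G (r * w)) (𝓝[<] 1) (𝓝 (∑' j, g j * w ^ j)) := by
    refine h1.congr' ?_
    filter_upwards [self_mem_nhdsWithin, mem_nhdsWithin_of_mem_nhds (lt_mem_nhds one_pos)]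
      with r hr1 hr0
    have hr1' : r < 1 := hr1
    have hz : (r * w : ℂ) ∈ ball (0 : ℂ) 1 := by
      rw [mem_ball_zero_iff, norm_mul, hw, mul_one, Complex.norm_real, Real.norm_of_nonneg hr0.le]
      exact hr1'
    rw [Function.comp_apply, ← (hG _ hz).tsum_eq]
    exact tsum_congr fun j => by rw [mul_pow]; ring
  rw [tendsto_nhds_unique hγ h2]
  exact hs.hasSum

end WeightedHardy

/-! ### The space `S²(𝔻)` as a weighted Hardy space. -/

/-- Termwise differentiation of a power series in the unit disk. -/
theorem hasDerivAt_tsum_mul_pow {a : ℕ → ℂ}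
    (ha : ∀ z ∈ ball (0 : ℂ) 1, Summable fun n => a n * z ^ n) {z : ℂ} (hz : z ∈ ball (0 : ℂ) 1) :
    HasDerivAt (fun z => ∑' n, a n * z ^ n) (∑' n : ℕ, (n + 1) * a (n + 1) * z ^ n) z := by
  have hz1 : ‖z‖ < 1 := by simpa using hz
  -- Convergence at radius `s` bounds the coefficients, and on the smaller disk of radius `r` the
  -- derivatives are dominated by `n (r/s)ⁿ`.
  obtain ⟨r, hzr, hr1⟩ := exists_between hz1
  obtain ⟨s, hrs, hs1⟩ := exists_between hr1
  have hr0 : 0 < r := (norm_nonneg z).trans_lt hzr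
  have hs0 : 0 < s := hr0.trans hrs
  have hs : Summable fun n => a n * (s : ℂ) ^ n :=
    ha s (by simpa [abs_of_pos hs0] using hs1)
  obtain ⟨C, hC⟩ := hs.tendsto_atTop_zero.norm.bddAbove_range
  have hC' : ∀ n, ‖a n‖ * s ^ n ≤ C := fun n => by
    have : ‖a n * (s : ℂ) ^ n‖ ≤ C := hC ⟨n, rfl⟩
    simpa [abs_of_pos hs0] using this
  have hrs1 : r / s < 1 := (div_lt_one hs0).2 hrs
  have hu : Summable fun n : ℕ => C / r * ((n : ℝ) * (r / s) ^ n) := by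
    have h := summable_pow_mul_geometric_of_norm_lt_one (R := ℝ) 1 (r := r / s)
      (by rwa [Real.norm_of_nonneg (by positivity)])
    simpa using h.mul_left (C / r)
  have hb : ∀ (n : ℕ) (y : ℂ), y ∈ ball (0 : ℂ) r →
      ‖a n * (n * y ^ (n - 1))‖ ≤ C / r * ((n : ℝ) * (r / s) ^ n) := by
    intro n y hy
    have hy' : ‖y‖ ≤ r := by simpa using (mem_ball_zero_iff.1 hy).le
    rcases n with _ | n
    · simp
    · rw [norm_mul, norm_mul, norm_pow, Complex.norm_natCast, Nat.add_sub_cancel, div_pow]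
      calc ‖a (n + 1)‖ * (((n + 1 : ℕ) : ℝ) * ‖y‖ ^ n)
          ≤ C / s ^ (n + 1) * (((n + 1 : ℕ) : ℝ) * r ^ n) := by
            have h1 : ‖a (n + 1)‖ ≤ C / s ^ (n + 1) := by
              rw [le_div_iff₀ (by positivity)]
              exact hC' (n + 1)
            have h2 := (norm_nonneg _).trans h1
            gcongr
        _ = _ := by
            rw [pow_succ r]
            field_simp
  have hd := hasDerivAt_tsum_of_isPreconnected (g := fun n y => a n * y ^ n)
    (g' := fun n y => a n * (n * y ^ (n - 1))) hu isOpen_ball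
    (convex_ball (0 : ℂ) r).isPreconnected
    (fun n y _ => (hasDerivAt_pow n y).const_mul (a n)) hb (y₀ := 0) (y := z)
    (mem_ball_self hr0) (ha 0 (mem_ball_self one_pos)) (by simpa using hzr)
  have hsum : Summable fun n => a n * (n * z ^ (n - 1)) :=
    Summable.of_norm_bounded hu fun n => hb n z (by simpa using hzr)
  have e : ∑' n : ℕ, (n + 1) * a (n + 1) * z ^ n = ∑' n : ℕ, a n * (n * z ^ (n - 1)) := by
    rw [hsum.tsum_eq_zero_add]
    simp only [Nat.cast_zero, zero_mul, mul_zero, zero_add, Nat.add_sub_cancel]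
    exact tsum_congr fun n => by push_cast; ring
  rw [e]
  exact hd

theorem isPowerWeight_sobolevWeight : IsPowerWeight sobolevWeight 1 1 where
  pos n := by
    unfold sobolevWeight
    split_ifs with h
    · exact one_pos
    · exact_mod_cast Nat.pos_of_ne_zero h
  limit_pos := one_pos
  tendsto := by
    refine tendsto_const_nhds.congr' ?_
    filter_upwards [eventually_ge_atTop 1] with n hn
    have : (n : ℝ) ≠ 0 := by positivity
    rw [sobolevWeight, if_neg (by omega), Real.rpow_one, div_self this]

theorem isPowerWeight_hardyWeight : IsPowerWeight hardyWeight 0 1 where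
  pos _ := one_pos
  limit_pos := one_pos
  tendsto := by simp [hardyWeight]

namespace WeightedHardy

theorem summable_toLp_succ {β : ℕ → ℝ} (F : WeightedHardy β) :
    Summable fun n => ‖F.toLp (n + 1)‖ ^ 2 :=
  (summable_nat_add_iff (f := fun n => ‖F.toLp n‖ ^ 2) 1).2 (hasSum_norm_toLp_sq F).summable

/-- The derivative, as a map from `S²` to `H²`. -/
def sobolevDeriv (F : WeightedHardy sobolevWeight) : WeightedHardy hardyWeight :=
  ofSeq hardyWeight (fun n => F.toLp (n + 1)) (summable_toLp_succ F)

/-- For `n ≥ 1` the stored sequence of `F` is `n aₙ`, the coefficients of `F'`, so differentiation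
merely drops the entry at `0`. -/
theorem hasDerivAt_eval_sobolev (F : WeightedHardy sobolevWeight) {z : ℂ}
    (hz : z ∈ ball (0 : ℂ) 1) : HasDerivAt F.eval ((sobolevDeriv F).eval z) z := by
  have hβ := isPowerWeight_sobolevWeight
  have h := hasDerivAt_tsum_mul_pow
    (fun z hz => (hasSum_eval hβ.pos hβ.limit_pos hβ.tendsto F hz).summable) hz
  have e : (sobolevDeriv F).eval z = ∑' n : ℕ, (n + 1) * F.coeff (n + 1) * z ^ n := ?_
  · rw [e]
    exact h
  refine tsum_congr fun n => ?_
  have hn : ((n : ℂ) + 1) ≠ 0 := by exact_mod_cast n.succ_ne_zero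
  rw [coeff, coeff, sobolevDeriv, toLp_ofSeq, hardyWeight, sobolevWeight, if_neg n.succ_ne_zero]
  push_cast
  field_simp

theorem eval_zero {β : ℕ → ℝ} (F : WeightedHardy β) : F.eval 0 = F.toLp 0 / β 0 := by
  rw [eval, tsum_eq_single 0 fun n hn => by rw [zero_pow hn, mul_zero], pow_zero, mul_one, coeff]

/-- For the converse, `f(0)` is prepended to the coefficients of `f'`; two functions on the disk
with equal derivatives and equal values at `0` coincide. -/
theorem mem_sobolevWeight_iff (f : ℂ → ℂ) : Mem sobolevWeight f ↔
    DifferentiableOn ℂ f (ball 0 1) ∧ Mem hardyWeight (deriv f) := by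
  constructor
  · rintro ⟨F, hF⟩
    have hd : ∀ z ∈ ball (0 : ℂ) 1, HasDerivAt f ((sobolevDeriv F).eval z) z := fun z hz =>
      (hasDerivAt_eval_sobolev F hz).congr_of_eventuallyEq
        (eventuallyEq_of_mem (isOpen_ball.mem_nhds hz) hF)
    exact ⟨fun z hz => (hd z hz).differentiableAt.differentiableWithinAt,
      sobolevDeriv F, fun z hz => (hd z hz).deriv⟩
  · rintro ⟨hf, F', hF'⟩
    let x : ℕ → ℂ := fun n => Nat.casesOn n (f 0) F'.toLp
    have hx : Summable fun n => ‖x n‖ ^ 2 :=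
      (summable_nat_add_iff (f := fun n => ‖x n‖ ^ 2) 1).1 (hasSum_norm_toLp_sq F').summable
    let F : WeightedHardy sobolevWeight := ofSeq sobolevWeight x hx
    have hFF' : sobolevDeriv F = F' := ext_toLp fun n => rfl
    refine ⟨F, isOpen_ball.eqOn_of_deriv_eq (convex_ball (0 : ℂ) 1).isPreconnected hf
      (fun z hz => (hasDerivAt_eval_sobolev F hz).differentiableAt.differentiableWithinAt)
      (fun z hz => ?_) (mem_ball_self one_pos) ?_⟩
    · rw [hF' z hz, (hasDerivAt_eval_sobolev F hz).deriv, hFF']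
    · rw [eval_zero]
      simp [F, x, sobolevWeight]

theorem norm_sq_sobolev (F : WeightedHardy sobolevWeight) (F' : WeightedHardy hardyWeight)
    (h : ∀ z ∈ ball (0 : ℂ) 1, deriv F.eval z = F'.eval z) :
    ‖F‖ ^ 2 = ‖F.eval 0‖ ^ 2 + ‖F'‖ ^ 2 := by
  have hβ := isPowerWeight_hardyWeight
  have e : F' = sobolevDeriv F := ext_eval hβ.pos hβ.limit_pos hβ.tendsto _ _ fun z hz => by
    rw [← h z hz, (hasDerivAt_eval_sobolev F hz).deriv]
  have h1 := hasSum_norm_toLp_sq F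
  have h2 := hasSum_norm_toLp_sq (sobolevDeriv F)
  rw [e, ← h1.tsum_eq, h1.summable.tsum_eq_zero_add, ← h2.tsum_eq, eval_zero]
  simp [sobolevDeriv, sobolevWeight]

end WeightedHardy

/-! ### Binomial series and the multiplier `(bz + 1)^(2t-1)`. -/

theorem Ring.choose_succ_mul (s : ℂ) (n : ℕ) :
    Ring.choose s (n + 1) * (n + 1) = Ring.choose s n * (s - n) := by
  rw [Ring.choose_eq_smul, Ring.choose_eq_smul, descPochhammer_succ_right, Polynomial.smeval_mul,
    Nat.factorial_succ]
  have h1 : ((n : ℂ) + 1) ≠ 0 := by exact_mod_cast n.succ_ne_zero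
  have h2 : ((n.factorial : ℕ) : ℂ) ≠ 0 := by exact_mod_cast n.factorial_ne_zero
  simp only [Polynomial.smeval_sub, Polynomial.smeval_X, Polynomial.smeval_natCast, pow_one,
    pow_zero, nsmul_eq_mul, mul_one, smul_eq_mul]
  push_cast
  field_simp

/-- The binomial coefficients `C(s, n)` are `O(n ^ (-s - 1))`. -/
theorem exists_norm_choose_mul_rpow_le {s : ℝ} (hs : 0 ≤ s) :
    ∃ C, ∀ n : ℕ, ‖Ring.choose (s : ℂ) n‖ * (n : ℝ) ^ (s + 1) ≤ C := by
  set u : ℕ → ℝ := fun n => ‖Ring.choose (s : ℂ) n‖ * (n : ℝ) ^ (s + 1) with hu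
  have hu0 : ∀ n, 0 ≤ u n := fun n => by simp only [hu]; positivity
  have hstep : ∀ n : ℕ, s ≤ n → u (n + 1) ≤ u n := by
    intro n hn
    have hn1 : (0 : ℝ) < (n : ℝ) + 1 := by positivity
    have hn0 : (0 : ℝ) ≤ n := n.cast_nonneg
    have h1 : ‖Ring.choose (s : ℂ) (n + 1)‖ * (n + 1) = ‖Ring.choose (s : ℂ) n‖ * (n - s) := by
      have h := congrArg norm (Ring.choose_succ_mul (s : ℂ) n)
      rw [norm_mul, norm_mul] at h
      have e1 : ‖(n : ℂ) + 1‖ = n + 1 := by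
        rw [← Nat.cast_succ, Complex.norm_natCast]; push_cast; ring
      have e2 : ‖(s : ℂ) - n‖ = n - s := by
        rw [norm_sub_rev, ← Complex.ofReal_natCast, ← Complex.ofReal_sub, Complex.norm_real,
          Real.norm_of_nonneg (by linarith)]
      rwa [e1, e2] at h
    -- Bernoulli's inequality at `-1/(n+1)`; it makes `u` nonincreasing from `n ≥ s` on.
    have h2 : ((n : ℝ) - s) / (n + 1) ≤ ((n : ℝ) / (n + 1)) ^ (s + 1) := by
      have h := one_add_mul_self_le_rpow_one_add (s := -1 / ((n : ℝ) + 1)) (p := s + 1)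
        (by rw [le_div_iff₀ hn1]; linarith) (by linarith)
      have e1 : 1 + (s + 1) * (-1 / ((n : ℝ) + 1)) = ((n : ℝ) - s) / (n + 1) := by
        field_simp; ring
      have e2 : 1 + -1 / ((n : ℝ) + 1) = (n : ℝ) / (n + 1) := by field_simp; ring
      rwa [e1, e2] at h
    have hX : (0 : ℝ) < ((n : ℝ) + 1) ^ (s + 1) := by positivity
    have h3 : ‖Ring.choose (s : ℂ) (n + 1)‖
        = ‖Ring.choose (s : ℂ) n‖ * (((n : ℝ) - s) / (n + 1)) := by
      rw [← mul_div_assoc, ← h1]; field_simp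
    simp only [hu]
    push_cast
    rw [h3]
    calc ‖Ring.choose (s : ℂ) n‖ * (((n : ℝ) - s) / (n + 1)) * ((n : ℝ) + 1) ^ (s + 1)
        ≤ ‖Ring.choose (s : ℂ) n‖ * ((n : ℝ) / (n + 1)) ^ (s + 1) * ((n : ℝ) + 1) ^ (s + 1) := by
          gcongr
      _ = _ := by rw [Real.div_rpow hn0 hn1.le]; field_simp
  obtain ⟨N, hN⟩ := exists_nat_ge s
  have htail : ∀ n, N ≤ n → u n ≤ u N := fun n hn => by
    induction n, hn using Nat.le_induction with
    | base => exact le_rfl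
    | succ n hn ih => exact (hstep n (hN.trans (by exact_mod_cast hn))).trans ih
  refine ⟨∑ i ∈ Finset.range (N + 1), u i, fun n => ?_⟩
  have hmem : ∀ i ≤ N, u i ≤ ∑ i ∈ Finset.range (N + 1), u i := fun i hi =>
    Finset.single_le_sum (f := u) (fun i _ => hu0 i) (by simp; omega)
  rcases le_total n N with h | h
  · exact hmem n h
  · exact (htail n h).trans (hmem N le_rfl)

theorem hasSum_choose_mul_pow (s : ℂ) {x : ℂ} (hx : ‖x‖ < 1) :
    HasSum (fun j => Ring.choose s j * x ^ j) ((1 + x) ^ s) := by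
  have h := (Complex.one_add_cpow_hasFPowerSeriesOnBall_zero (a := s)).hasSum (y := x) (by
    rw [← ENNReal.ofReal_one, Metric.eball_ofReal]
    simpa using hx)
  simpa [binomialSeries, FormalMultilinearSeries.coeff_ofScalars, mul_comm] using h

namespace WeightedHardy

variable {β : ℕ → ℝ} {t ℓ : ℝ}

theorem hasSum_binomial_ball (s : ℂ) {b : ℂ} (hb : ‖b‖ ≤ 1) {z : ℂ} (hz : z ∈ ball (0 : ℂ) 1) :
    HasSum (fun j => Ring.choose s j * b ^ j * z ^ j) ((b * z + 1) ^ s) := by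
  have hz1 : ‖z‖ < 1 := by simpa using hz
  have h := hasSum_choose_mul_pow s (x := b * z) (by
    rw [norm_mul]; nlinarith [norm_nonneg z, norm_nonneg b])
  rw [add_comm]
  simpa only [mul_pow, mul_assoc] using h

/-- Convergence of the binomial series at some `r` with `|b| < r < 1` bounds its coefficients by `C
r⁻ʲ`, so those of `G` decay like `(|b|/r)ʲ`. -/
theorem exists_isShiftSeries_of_norm_lt (hβ : IsPowerWeight β t ℓ)
    {S : WeightedHardy β →L[ℂ] WeightedHardy β}
    (hS : ∀ n m, entry S n m = (if n = m + 1 then 1 else 0) * (β n / β m)) (s : ℂ) {b : ℂ}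
    (hb : ‖b‖ < 1) : ∃ M, IsShiftSeries S (fun z => (b * z + 1) ^ s) M := by
  obtain ⟨r, hbr, hr1⟩ := exists_between hb
  have hr0 : 0 < r := (norm_nonneg b).trans_lt hbr
  have hs := (hasSum_choose_mul_pow s (x := (r : ℂ)) (by simpa [abs_of_pos hr0] using hr1)).summable
  obtain ⟨C, hC⟩ := hs.tendsto_atTop_zero.norm.bddAbove_range
  have hC' : ∀ n, ‖Ring.choose s n‖ * r ^ n ≤ C := fun n => by
    have : ‖Ring.choose s n * (r : ℂ) ^ n‖ ≤ C := hC ⟨n, rfl⟩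
    simpa [abs_of_pos hr0] using this
  have hg : ∀ j, ‖Ring.choose s j * b ^ j‖ ≤ C * (‖b‖ / r) ^ j := fun j => by
    rw [norm_mul, norm_pow, div_pow]
    calc ‖Ring.choose s j‖ * ‖b‖ ^ j = ‖Ring.choose s j‖ * r ^ j * (‖b‖ ^ j / r ^ j) := by
          field_simp
      _ ≤ _ := by gcongr; exact hC' j
  have hq : ‖b‖ / r < 1 := (div_lt_one hr0).2 hbr
  obtain ⟨M, hM⟩ := summable_shift_of_geometric hβ hS (by positivity) hq hg
  exact ⟨M, _, Summable.of_nonneg_of_le (fun _ => norm_nonneg _) hg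
    ((summable_geometric_of_lt_one (by positivity) hq).mul_left C),
    fun z hz => hasSum_binomial_ball s hb.le hz, hM⟩

/-- The coefficients are `O(j^(-2t))` and the weights `O(jᵗ)`, so the squared products are
`O(j^(-2t))`, summable for `t > 1/2`. -/
theorem exists_isShiftSeries_of_norm_eq (hβ : IsPowerWeight β t ℓ) (ht : 1 / 2 < t)
    {S : WeightedHardy β →L[ℂ] WeightedHardy β}
    (hS : ∀ n m, entry S n m = (if n = m + 1 then 1 else 0) * (β n / β m)) {b : ℂ}
    (hb : ‖b‖ = 1) : ∃ M, IsShiftSeries S (fun z => (b * z + 1) ^ ((2 * t - 1 : ℝ) : ℂ)) M := by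
  obtain ⟨C, hC⟩ := exists_norm_choose_mul_rpow_le (s := 2 * t - 1) (by linarith)
  obtain ⟨_, _, D, hD, hβD⟩ := hβ.exists_bounds
  have hC0 : 0 ≤ C := (by positivity : (0 : ℝ) ≤ _).trans (hC 0)
  have hsq : Summable fun j =>
      (‖Ring.choose ((2 * t - 1 : ℝ) : ℂ) j * b ^ j‖ * β j) ^ 2 := by
    rw [← summable_nat_add_iff 1]
    have hs := ((summable_nat_add_iff 1).2
      (Real.summable_one_div_nat_rpow.2 (by linarith : 1 < 2 * t))).mul_left ((C * (D * 2 ^ t)) ^ 2)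
    refine Summable.of_nonneg_of_le (fun j => sq_nonneg _) (fun j => ?_) hs
    rw [norm_mul, norm_pow, hb, one_pow, mul_one]
    set x : ℝ := ((j + 1 : ℕ) : ℝ) with hx
    have hx1 : 1 ≤ x := by rw [hx]; exact_mod_cast Nat.succ_pos j
    have hx0 : 0 < x := by linarith
    have h1 : ‖Ring.choose ((2 * t - 1 : ℝ) : ℂ) (j + 1)‖ ≤ C / x ^ (2 * t) := by
      rw [le_div_iff₀ (by positivity)]
      have := hC (j + 1)
      rwa [sub_add_cancel] at this
    have h2 : β (j + 1) ≤ D * 2 ^ t * x ^ t := by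
      calc β (j + 1) ≤ D * (x + 1) ^ t := (hβD (j + 1)).2
        _ ≤ D * (2 * x) ^ t := by
            gcongr
            linarith
        _ = _ := by rw [Real.mul_rpow (by norm_num) hx0.le]; ring
    have e : x ^ (2 * t) = x ^ t * x ^ t := by rw [two_mul, Real.rpow_add hx0]
    have hX : 0 < x ^ t := by positivity
    have hb0 := hβ.pos (j + 1)
    calc (‖Ring.choose ((2 * t - 1 : ℝ) : ℂ) (j + 1)‖ * β (j + 1)) ^ 2
        ≤ (C / x ^ (2 * t) * (D * 2 ^ t * x ^ t)) ^ 2 := by gcongr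
      _ = _ := by rw [e]; field_simp
  obtain ⟨M, hM⟩ := summable_shift_of_sq hβ ht hS hsq
  exact ⟨M, _, summable_norm_of_sq hβ ht hsq, fun z hz => hasSum_binomial_ball _ hb.le hz, hM⟩

/-- A multiplier is bounded by the norm of its multiplication operator. -/
theorem IsMultiplicationOperator.norm_le (hβ : IsPowerWeight β t ℓ) {G : ℂ → ℂ}
    {M : WeightedHardy β →L[ℂ] WeightedHardy β} (hM : IsMultiplicationOperator G M) {z : ℂ}
    (hz : z ∈ ball (0 : ℂ) 1) : ‖G z‖ ≤ ‖M‖ := by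
  obtain ⟨ev, hev⟩ := exists_eval_clm hβ hz
  -- Point evaluation is an eigenvector of the transpose of `M` with eigenvalue `G z`.
  have h1 : ev.comp M = G z • ev := by
    ext f
    rw [ContinuousLinearMap.comp_apply, hev, hM f z hz, smul_apply, hev, smul_eq_mul]
  have h0 : ev ≠ 0 := fun h => by
    have h2 := hev (unit β 0)
    rw [h, eval_unit, pow_zero, zero_apply] at h2
    have : (β 0 : ℂ) ≠ 0 := by exact_mod_cast (hβ.pos 0).ne'
    exact one_div_ne_zero this h2.symm
  have h3 := ev.opNorm_comp_le M
  rw [h1, norm_smul, mul_comm] at h3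
  exact le_of_mul_le_mul_left h3 (norm_pos_iff.2 h0)

/-- If `|b| ≥ 1`, then `bz + 1` takes arbitrarily small positive values in the disk, and its
negative power is unbounded there, unlike a multiplier. -/
theorem norm_lt_one_of_isMultiplicationOperator (hβ : IsPowerWeight β t ℓ) {s : ℝ} (hs : s < 0)
    {b : ℂ} {M : WeightedHardy β →L[ℂ] WeightedHardy β}
    (hM : IsMultiplicationOperator (fun z => (b * z + 1) ^ (s : ℂ)) M) : ‖b‖ < 1 := by
  by_contra! hb
  have hb0 : b ≠ 0 := norm_pos_iff.1 (by linarith)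
  have hM0 := norm_nonneg M
  -- Chosen so that `xˢ = ‖M‖ + 2`, with `bz + 1 = x` at `z = (x-1)/b`.
  set x : ℝ := (‖M‖ + 2) ^ s⁻¹ with hx
  have hx0 : 0 < x := by positivity
  have hx1 : x < 1 := Real.rpow_lt_one_of_one_lt_of_neg (by linarith) (inv_lt_zero.2 hs)
  have hz : ((x - 1 : ℝ) : ℂ) / b ∈ ball (0 : ℂ) 1 := by
    rw [mem_ball_zero_iff, norm_div, div_lt_one (by linarith), Complex.norm_real,
      Real.norm_of_nonpos (by linarith)]
    linarith
  have h := hM.norm_le hβ hz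
  have e : b * (((x - 1 : ℝ) : ℂ) / b) + 1 = (x : ℂ) := by
    rw [mul_div_cancel₀ _ hb0]; push_cast; ring
  simp only [e] at h
  rw [Complex.norm_cpow_real, Complex.norm_real, Real.norm_of_nonneg hx0.le, hx,
    ← Real.rpow_mul (by linarith), inv_mul_cancel₀ hs.ne, Real.rpow_one] at h
  linarith

theorem exists_isMultiplicationOperator_cpow (hβ : IsPowerWeight β t ℓ) {b : ℂ}
    (h : ‖b‖ < 1 ∨ (‖b‖ = 1 ∧ 1 / 2 ≤ t) ∨ ∃ k : ℕ, 2 * t - 1 = (k : ℝ)) :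
    ∃ M : WeightedHardy β →L[ℂ] WeightedHardy β,
      IsMultiplicationOperator (fun z => (b * z + 1) ^ ((2 * t - 1 : ℝ) : ℂ)) M := by
  obtain ⟨S, hS, hS'⟩ := exists_shift hβ
  have hnat : ∀ k : ℕ, 2 * t - 1 = (k : ℝ) → ∃ M : WeightedHardy β →L[ℂ] WeightedHardy β,
      IsMultiplicationOperator (fun z => (b * z + 1) ^ ((2 * t - 1 : ℝ) : ℂ)) M := fun k hk =>
    ⟨(b • S + 1) ^ k, ((hS.one_add_smul hβ b).pow k).congr fun z _ => by
      rw [hk, Complex.ofReal_natCast, Complex.cpow_natCast]⟩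
  rcases h with h | ⟨h, ht⟩ | ⟨k, hk⟩
  · obtain ⟨M, hM⟩ := exists_isShiftSeries_of_norm_lt hβ hS' ((2 * t - 1 : ℝ) : ℂ) h
    exact ⟨M, hM.isMultiplicationOperator hβ hS⟩
  · rcases ht.eq_or_lt with ht | ht
    · exact hnat 0 (by rw [← ht]; norm_num)
    · obtain ⟨M, hM⟩ := exists_isShiftSeries_of_norm_eq hβ ht hS' h
      exact ⟨M, hM.isMultiplicationOperator hβ hS⟩
  · exact hnat k hk

/-- A multiplier `(bz + 1) ^ (2t - 1)` of `H²(β)` with `t ≠ 1/2` is a norm-convergent power series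
in the shift. -/
theorem isShiftSeries_cpow (hβ : IsPowerWeight β t ℓ) (ht : t ≠ 1 / 2)
    {S M : WeightedHardy β →L[ℂ] WeightedHardy β} (hS : IsMultiplicationOperator (fun z => z) S)
    (hS' : ∀ n m, entry S n m = (if n = m + 1 then 1 else 0) * (β n / β m)) {b : ℂ}
    (hM : IsMultiplicationOperator (fun z => (b * z + 1) ^ ((2 * t - 1 : ℝ) : ℂ)) M) :
    IsShiftSeries S (fun z => (b * z + 1) ^ ((2 * t - 1 : ℝ) : ℂ)) M := by
  rcases ht.lt_or_gt with ht | ht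
  · have hb := norm_lt_one_of_isMultiplicationOperator hβ (by linarith) hM
    obtain ⟨N, hN⟩ := exists_isShiftSeries_of_norm_lt hβ hS' ((2 * t - 1 : ℝ) : ℂ) hb
    rwa [hM.unique hβ (hN.isMultiplicationOperator hβ hS)]
  · exact isShiftSeries_of_isMultiplicationOperator hβ ht hS hS' hM

/-! ### The self-map condition and the adjoint formula. -/

/-- If `a z / (c z + d)` maps the disk to itself, then `|a| + |c| ≤ |d|`. -/
theorem norm_add_norm_le_of_mapsTo {a c d : ℂ}
    (hd : ∀ z ∈ ball (0 : ℂ) 1, c * z + d ≠ 0)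
    (hφ : MapsTo (fun z : ℂ => a * z / (c * z + d)) (ball 0 1) (ball 0 1)) :
    ‖a‖ + ‖c‖ ≤ ‖d‖ := by
  have hd0 : d ≠ 0 := by simpa using hd 0 (mem_ball_self one_pos)
  have hd1 : 0 < ‖d‖ := norm_pos_iff.2 hd0
  have hdC : (‖d‖ : ℂ) ≠ 0 := by exact_mod_cast hd1.ne'
  have hcd : ‖c‖ ≤ ‖d‖ := by
    by_contra! h
    have hc0 : c ≠ 0 := norm_pos_iff.1 (hd1.trans h)
    refine hd (-d / c) ?_ (by field_simp; ring)
    rw [mem_ball_zero_iff, norm_div, norm_neg, div_lt_one (hd1.trans h)]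
    exact h
  obtain ⟨u, hu, hcu⟩ : ∃ u : ℂ, ‖u‖ = 1 ∧ c * u = ‖c‖ * (d / ‖d‖) := by
    by_cases hc : c = 0
    · exact ⟨1, norm_one, by simp [hc]⟩
    · have hc1 : (‖c‖ : ℂ) ≠ 0 := by exact_mod_cast (norm_pos_iff.2 hc).ne'
      refine ⟨‖c‖ / c * (d / ‖d‖), ?_, by field_simp⟩
      have : ‖c‖ ≠ 0 := (norm_pos_iff.2 hc).ne'
      simp only [norm_mul, norm_div, Complex.norm_real, norm_norm]
      field_simp
  by_contra! h
  -- At `z = -ru` the terms `cz` and `d` are opposed, so `|cz + d| = |d| - r|c| = r|a| = |az|`. Thus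
  -- `φ(z)` would have modulus `1`.
  set r : ℝ := ‖d‖ / (‖a‖ + ‖c‖) with hr
  have hs0 : 0 < ‖a‖ + ‖c‖ := hd1.trans h
  have hr0 : 0 < r := by positivity
  have hr1 : r < 1 := (div_lt_one hs0).2 h
  have hz : (-(r * u) : ℂ) ∈ ball (0 : ℂ) 1 := by
    rw [mem_ball_zero_iff, norm_neg, norm_mul, hu, mul_one, Complex.norm_real,
      Real.norm_of_nonneg hr0.le]
    exact hr1
  have h1 := hφ hz
  simp only [mem_ball_zero_iff] at h1
  rw [norm_div, div_lt_one (norm_pos_iff.2 (hd _ hz))] at h1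
  have e1 : ‖a * -(r * u)‖ = r * ‖a‖ := by
    rw [norm_mul, norm_neg, norm_mul, hu, Complex.norm_real, Real.norm_of_nonneg hr0.le]; ring
  have e2 : ‖c * -(r * u) + d‖ = ‖d‖ - r * ‖c‖ := by
    have e3 : c * -(r * u) + d = ((‖d‖ - r * ‖c‖ : ℝ) : ℂ) * (d / ‖d‖) := by
      have : c * -(r * u) = -(r * (c * u)) := by ring
      rw [this, hcu]
      push_cast
      field_simp
      ring
    rw [e3, norm_mul, norm_div, Complex.norm_real, Complex.norm_real, norm_norm,
      div_self hd1.ne', mul_one, Real.norm_of_nonneg]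
    nlinarith [norm_nonneg c]
  rw [e1, e2] at h1
  have e4 : r * (‖a‖ + ‖c‖) = ‖d‖ := by rw [hr]; field_simp
  linarith

/-- Modulo compacts `M_G*` acts on the range of `C_σ` as the scalar `conj(G(w))`, with `w` the point
of contact. Since `|a| + |c| = |d|`, this equals `(|d|/|a|)^(2t-1)`, the constant relating `C_φ*` to
`C_σ`. -/
theorem isCompactOperator_adjoint_multiplication_comp_sub (hβ : IsPowerWeight β t ℓ) {a c d : ℂ}
    (ha : a ≠ 0) (hd : d ≠ 0) (hacd : ‖a‖ + ‖c‖ = ‖d‖)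
    {K M : WeightedHardy β →L[ℂ] WeightedHardy β}
    (hK : ∀ n m, entry K n m = affineCoeff (star (a / d)) (star (-c / d)) n m * (β n / β m))
    (hM : IsMultiplicationOperator (fun z => (-(c / a) * z + 1) ^ ((2 * t - 1 : ℝ) : ℂ)) M) :
    IsCompactOperator (ContinuousLinearMap.adjoint M ∘L K
      - ((‖a / d‖ ^ (1 - 2 * t) : ℝ) : ℂ) • K) := by
  have ha1 : 0 < ‖a‖ := norm_pos_iff.2 ha
  have hd1 : 0 < ‖d‖ := norm_pos_iff.2 hd
  -- In both cases `G = 1`. For `c = 0` the map `σ` is a rotation and no single contact point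
  -- exists.
  by_cases htriv : c = 0 ∨ t = 1 / 2
  · have hM1 : M = 1 := hM.unique hβ (IsMultiplicationOperator.one.congr fun z _ => by
      rcases htriv with rfl | rfl
      · simp
      · norm_num)
    have hlam : ‖a / d‖ ^ (1 - 2 * t) = 1 := by
      rcases htriv with rfl | rfl
      · rw [norm_zero, add_zero] at hacd
        rw [norm_div, hacd, div_self hd1.ne', Real.one_rpow]
      · norm_num
    have e : ContinuousLinearMap.adjoint M ∘L K - ((‖a / d‖ ^ (1 - 2 * t) : ℝ) : ℂ) • K = 0 := by
      rw [hlam, hM1, ← ContinuousLinearMap.star_eq_adjoint, star_one]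
      ext f
      simp
    rw [e]
    exact isCompactOperator_zero
  push Not at htriv
  obtain ⟨hc, ht⟩ := htriv
  have hc1 : 0 < ‖c‖ := norm_pos_iff.2 hc
  have haC : (‖a‖ : ℂ) ≠ 0 := by exact_mod_cast ha1.ne'
  have hdC : (‖d‖ : ℂ) ≠ 0 := by exact_mod_cast hd1.ne'
  obtain ⟨S, hS, hS'⟩ := exists_shift hβ
  -- The boundary point with `-(c/a)w = |c|/|a|`; `σ` sends it to the circle, and `G` is positive
  -- along the radius to it.
  set w : ℂ := -(a / c) * (‖c‖ / ‖a‖) with hw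
  have hw1 : ‖w‖ = 1 := by
    rw [hw]
    simp only [norm_mul, norm_div, norm_neg, Complex.norm_real, norm_norm]
    field_simp
  have hcomp := isCompactOperator_adjoint_shift_comp_sub hβ (P := star (a / d))
    (Q := star (-c / d)) (ω := star w) (star_ne_zero.2 (div_ne_zero ha hd))
    (star_ne_zero.2 (div_ne_zero (neg_ne_zero.2 hc) hd))
    (by rw [norm_star, norm_star, norm_div, norm_div, norm_neg]; field_simp; exact hacd)
    (by rw [norm_star, hw1])
    (by
      have h : a / d * ‖-c / d‖ = w * (-c / d) * ‖a / d‖ := by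
        rw [hw, norm_div, norm_div, norm_neg]
        push_cast
        field_simp
      have h' := congrArg star h
      simp only [star_mul', Complex.star_def, Complex.conj_ofReal] at h'
      simpa only [norm_star, Complex.star_def, RCLike.norm_conj] using h')
    hS' hK
  obtain ⟨g, hg, hgG, hgM⟩ := isShiftSeries_cpow hβ ht hS hS' hM
  have hγ : HasSum (fun j => g j * w ^ j) ((‖a / d‖ ^ (1 - 2 * t) : ℝ) : ℂ) := by
    refine hasSum_of_tendsto_radial hg hw1 hgG ?_
    have hlim : Tendsto (fun r : ℝ => (r * (‖c‖ / ‖a‖) + 1) ^ (2 * t - 1)) (𝓝[<] 1)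
        (𝓝 ((1 * (‖c‖ / ‖a‖) + 1) ^ (2 * t - 1))) := by
      refine Tendsto.mono_left ?_ nhdsWithin_le_nhds
      exact ((tendsto_id.mul_const _).add_const 1).rpow_const (Or.inl (by positivity))
    have e : (1 * (‖c‖ / ‖a‖) + 1) ^ (2 * t - 1) = ‖a / d‖ ^ (1 - 2 * t) := by
      have h1 : 1 * (‖c‖ / ‖a‖) + 1 = ‖a / d‖⁻¹ := by
        rw [norm_div, ← hacd]; field_simp; ring
      rw [h1, Real.inv_rpow (norm_nonneg _), ← Real.rpow_neg (norm_nonneg _)]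
      congr 1
      ring
    rw [e] at hlim
    refine ((Complex.continuous_ofReal.tendsto _).comp hlim).congr' ?_
    filter_upwards [mem_nhdsWithin_of_mem_nhds (lt_mem_nhds one_pos)] with r hr
    have h2 : -(c / a) * (r * w) + 1 = ((r * (‖c‖ / ‖a‖) + 1 : ℝ) : ℂ) := by
      rw [hw]
      push_cast
      field_simp
    have hr0 : 0 < r := hr
    simp only [Function.comp_apply]
    rw [h2, Complex.ofReal_cpow (by positivity)]
  have hfin := isCompactOperator_adjoint_series_comp_sub hcomp hgM (by rwa [star_star])
  rwa [Complex.star_def, Complex.conj_ofReal] at hfin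

/-- The adjoint formula modulo compact operators on `H²(β)`. -/
theorem exists_adjoint_formula (hβ : IsPowerWeight β t ℓ) {a c d : ℂ} (ha : a ≠ 0)
    (hd : ∀ z ∈ ball (0 : ℂ) 1, c * z + d ≠ 0)
    (hφ : MapsTo (fun z : ℂ => a * z / (c * z + d)) (ball 0 1) (ball 0 1)) :
    ∃ Cφ Cσ : WeightedHardy β →L[ℂ] WeightedHardy β,
      IsCompositionOperator (fun z => a * z / (c * z + d)) Cφ ∧
      IsCompositionOperator (fun z => star a / star d * z - star c / star d) Cσ ∧
      ∀ MG : WeightedHardy β →L[ℂ] WeightedHardy β,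
        IsMultiplicationOperator (fun z => (-(c / a) * z + 1) ^ ((2 * t - 1 : ℝ) : ℂ)) MG →
        IsCompactOperator
          (ContinuousLinearMap.adjoint Cφ - ContinuousLinearMap.adjoint MG ∘L Cσ) := by
  have hacd := norm_add_norm_le_of_mapsTo hd hφ
  have hd0 : d ≠ 0 := by simpa using hd 0 (mem_ball_self one_pos)
  have hd1 : 0 < ‖d‖ := norm_pos_iff.2 hd0
  have hP : a / d ≠ 0 := div_ne_zero ha hd0
  have hP' : star (a / d) ≠ 0 := star_ne_zero.2 hP
  have hsum : ‖a / d‖ + ‖-c / d‖ = (‖a‖ + ‖c‖) / ‖d‖ := by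
    rw [norm_div, norm_div, norm_neg, add_div]
  have hPQ : ‖a / d‖ + ‖-c / d‖ ≤ 1 := by rw [hsum, div_le_one hd1]; exact hacd
  have hPQ' : ‖star (a / d)‖ + ‖star (-c / d)‖ ≤ 1 := by rwa [norm_star, norm_star]
  obtain ⟨Cφ, hCφ⟩ := exists_fractional hβ hP hPQ
  obtain ⟨Cσ, hCσ⟩ := exists_affine hβ hP' hPQ'
  have hσ : ∀ z : ℂ, star a / star d * z - star c / star d
      = star (a / d) * z + star (-c / d) := fun z => by
    simp only [star_div₀, star_neg]; ring
  refine ⟨Cφ, Cσ, isCompositionOperator_fractional hβ (by linarith [norm_nonneg (a / d)]) hCφ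
    (fun z hz => ?_) hφ, isCompositionOperator_affine hβ hCσ (fun z _ => hσ z) fun z hz => ?_,
    fun MG hMG => ?_⟩
  · have h1 : 1 - -c / d * z = (c * z + d) / d := by field_simp; ring
    have := hd z hz
    rw [h1]
    field_simp
  · have hz1 : ‖z‖ < 1 := by simpa using hz
    rw [mem_ball_zero_iff, hσ]
    refine (norm_add_le _ _).trans_lt (lt_of_lt_of_le ?_ hPQ')
    rw [norm_mul]
    have := norm_pos_iff.2 hP'
    gcongr
    exact mul_lt_of_lt_one_right this hz1
  -- Equality is contact with the circle, where the constants match. Under strict inequality `C_φ*`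
  -- and `C_σ` are separately compact.
  · rcases hacd.eq_or_lt with h | h
    · have h1 := isCompactOperator_adjoint_fractional_sub hβ hP
        (by rw [hsum, h, div_self hd1.ne']) hCφ hCσ
      have h2 := isCompactOperator_adjoint_multiplication_comp_sub hβ ha hd0 h hCσ hMG
      have h3 := h1.sub h2
      convert! h3 using 1
      ext f
      simp
    · have h1 := isCompactOperator_adjoint_fractional hβ hP
        (by rw [hsum, div_lt_one hd1]; exact h) hCφ
      have h2 := isCompactOperator_affine hβ hP'
        (by rw [norm_star, norm_star, hsum, div_lt_one hd1]; exact h) hCσ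
      exact h1.sub (h2.clm_comp (ContinuousLinearMap.adjoint MG))

end WeightedHardy

end

theorem corollary3p3 (a c d : ℂ) (ha : a ≠ 0)
    (hd : ∀ z ∈ ball (0 : ℂ) 1, c * z + d ≠ 0)
    (hφ : MapsTo (fun z : ℂ => a * z / (c * z + d)) (ball 0 1) (ball 0 1)) :
    -- the adjoint formula on `H²(β)`
    (∀ (β : ℕ → ℝ) (t ℓ : ℝ), (∀ n, 0 < β n) → 0 < ℓ →
      Tendsto (fun n : ℕ => β n / (n : ℝ) ^ t) atTop (𝓝 ℓ) →
      ∃ Cφ Cσ : WeightedHardy β →L[ℂ] WeightedHardy β,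
        WeightedHardy.IsCompositionOperator (fun z => a * z / (c * z + d)) Cφ ∧
        WeightedHardy.IsCompositionOperator
          (fun z => star a / star d * z - star c / star d) Cσ ∧
        ((‖c‖ < ‖a‖ ∨ (‖c‖ = ‖a‖ ∧ 1 / 2 ≤ t) ∨ ∃ k : ℕ, 2 * t - 1 = (k : ℝ)) →
          ∃ MG : WeightedHardy β →L[ℂ] WeightedHardy β,
            WeightedHardy.IsMultiplicationOperator
              (fun z => (-(c / a) * z + 1) ^ ((2 * t - 1 : ℝ) : ℂ)) MG) ∧
        ∀ MG : WeightedHardy β →L[ℂ] WeightedHardy β,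
          WeightedHardy.IsMultiplicationOperator
            (fun z => (-(c / a) * z + 1) ^ ((2 * t - 1 : ℝ) : ℂ)) MG →
          IsCompactOperator
            (ContinuousLinearMap.adjoint Cφ - ContinuousLinearMap.adjoint MG ∘L Cσ)) ∧
    -- `S²(𝔻)`, the space of analytic `f` with `f' ∈ H²` and `‖f‖² = |f(0)|² + ‖f'‖²`,
    -- is `H²(β)` for the weights `1, 1, 2, 3, …`
    (∀ f : ℂ → ℂ, WeightedHardy.Mem sobolevWeight f ↔
      DifferentiableOn ℂ f (ball 0 1) ∧ WeightedHardy.Mem hardyWeight (deriv f)) ∧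
    (∀ (F : WeightedHardy sobolevWeight) (F' : WeightedHardy hardyWeight),
      (∀ z ∈ ball (0 : ℂ) 1, deriv F.eval z = F'.eval z) →
      ‖F‖ ^ 2 = ‖F.eval 0‖ ^ 2 + ‖F'‖ ^ 2) ∧
    -- the adjoint formula on `S²(𝔻)`
    ∃ Cφ Cσ MG : WeightedHardy sobolevWeight →L[ℂ] WeightedHardy sobolevWeight,
      WeightedHardy.IsCompositionOperator (fun z => a * z / (c * z + d)) Cφ ∧
      WeightedHardy.IsCompositionOperator
        (fun z => star a / star d * z - star c / star d) Cσ ∧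
      WeightedHardy.IsMultiplicationOperator (fun z => -(c / a) * z + 1) MG ∧
      IsCompactOperator
        (ContinuousLinearMap.adjoint Cφ - ContinuousLinearMap.adjoint MG ∘L Cσ) := by
  have hba : ‖-(c / a)‖ = ‖c‖ / ‖a‖ := by rw [norm_neg, norm_div]
  have ha1 : 0 < ‖a‖ := norm_pos_iff.2 ha
  refine ⟨fun β t ℓ hpos hℓ hlim => ?_, WeightedHardy.mem_sobolevWeight_iff,
    WeightedHardy.norm_sq_sobolev, ?_⟩
  · have hβ : IsPowerWeight β t ℓ := ⟨hpos, hℓ, hlim⟩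
    obtain ⟨Cφ, Cσ, h1, h2, h3⟩ := WeightedHardy.exists_adjoint_formula hβ ha hd hφ
    refine ⟨Cφ, Cσ, h1, h2, fun h => WeightedHardy.exists_isMultiplicationOperator_cpow hβ ?_, h3⟩
    rwa [hba, div_lt_one ha1, div_eq_one_iff_eq ha1.ne']
  · have hβ := isPowerWeight_sobolevWeight
    obtain ⟨Cφ, Cσ, h1, h2, h3⟩ := WeightedHardy.exists_adjoint_formula hβ ha hd hφ
    obtain ⟨MG, hMG⟩ := WeightedHardy.exists_isMultiplicationOperator_cpow hβ (b := -(c / a))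
      -- For `t = 1` the exponent `2t - 1` is `1`.
      (Or.inr (Or.inr ⟨1, by norm_num⟩))
    refine ⟨Cφ, Cσ, MG, h1, h2, hMG.congr fun z _ => ?_, h3 MG hMG⟩
    norm_num
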